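/- \textbf{Setting.} A \emph{filter} $\mathcal F=(C,\{\mathcal F_i\}_{i\in I})$ is a set $C$ with a nonempty family of subsets $\mathcal F_i\subseteq C$ ($I$ a set) such that for all $i,j\in I$ there is $k\in I$ with $\mathcal F_k\subseteq\mathcal F_i\cap\mathcal F_j$. A continuous partial map $\alpha:(C,\mathcal F_I)\to(D,\mathcal G_J)$ is a function $\alpha:\mathcal F_i\to D$ for some $i\in I$ such that for every $j\in J$ there is $i'\in I$ with $\mathcal F_{i'}\subseteq\{u\in \mathcal F_i\mid \alpha(u)\in\mathcal G_j\}$; two such maps are equivalent if they are defined and agree on some $\mathcal F_k$. Filters and equivalence classes of continuous partial maps form the category $\mathfrak F\mathbf{Set}$. A set $S$ is identified with the filter $(S,\{S\})$. A finite family $\{\beta_k:\mathcal G_k\to\mathcal F\}_{k=1}^n$ is a \emph{$K$-cover} if for every choice of base sets $\mathcal G_{k,j_k}$ there is $i$ with $\mathcal F_i\subseteq\bigcup_{k}\beta_k(\mathcal G_{k,j_k})$ (images of the parts on which representatives are defined). Let $\mathcal N=\mathrm{Sh}(\mathfrak F\mathbf{Set},K)$, and let $\mathbf y$ be the Yoneda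 embedding (representables are $K$-sheaves). Let $\mathcal L$ be a many-sorted first-order language with equality whose types are closed under $S\mapsto S^*$ (finite sequences of elements of $S$), with membership $x\in s$ for $x:S$, $s:S^*$, and fix an interpretation of $\mathcal L$ in sets, $S^*$ being interpreted by the finite sequences of elements of $S$. Let $\mathcal L_{\mathrm{st}}$ extend $\mathcal L$ by a unary predicate $\mathrm{st}_S$ for each type $S$. Formulae of $\mathcal L$ are called \emph{internal}. Write $\forall^{\mathrm{st}}x\,\Phi$ for $\forall x\,(\mathrm{st}(x)\to\Phi)$, $\exists^{\mathrm{st}}x\,\Phi$ for $\exists x\,(\mathrm{st}(x)\wedge\Phi)$, and $\exists y\in t\,\Phi$ for $\exists y\,(y\in t\wedge\Phi)$. Interpret $\mathcal L_{\mathrm{st}}$ in $\mathcal N$: types, function symbols, relation symbols, equality and membership are interpreted by $\mathbf y$ of their interpretation in sets; $\mathrm{st}_S$ is interpreted by the subsheaf $\Delta S\subseteq\mathbf yS$ of morphisms $\mathcal F\to S$ that take a finite number of values; connectives and quantifiers are interpreted by the Heyting category structure of $\mathcal N$. A formula with free variables of types $S_1,\dots,S_n$ \emph{holds in $\mathcal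 N$} if its interpretation is the maximal subobject of $\mathbf y(S_1\times\dots\times S_n)$. \textbf{Proposition.} The herbrandised independence of premise principle $\mathsf{HIP}_{\forall^{\mathrm{st}}}$ holds in $\mathcal N$: for all types $S,T$, every internal formula $\varphi(x)$ with $x:S$, and every formula $\Psi(y)$ of $\mathcal L_{\mathrm{st}}$ with $y:T$, where $\varphi$ and $\Psi$ may contain further free variables (parameters) of any types, the formula \[ \big(\forall^{\mathrm{st}}x:S\;\varphi(x)\to\exists^{\mathrm{st}}y:T\;\Psi(y)\big)\to\exists^{\mathrm{st}}t:T^*\;\big(\forall^{\mathrm{st}}x:S\;\varphi(x)\to\exists y\in t\;\Psi(y)\big) \] holds in $\mathcal N$. -/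

import Mathlib

open CategoryTheory Opposite Filter

universe u v

namespace FilterTopos

/-! ### The category of filters of sets -/

/-- A filter base on a set: a nonempty family of subsets, indexed by a set, such that
any two members contain a third one. These are the objects of the category of filters. -/
structure FilterObj : Type (u + 1) where
  carrier : Type u
  Idx : Type u
  base : Idx → Set carrier
  inhabited : Nonempty Idx
  directed : ∀ i j, ∃ k, base k ⊆ base i ∩ base j

/-- The filter generated by a filter base. -/
def FilterObj.gen (F : FilterObj.{u}) : Filter F.carrier where
  sets := {A | ∃ i, F.base i ⊆ A}
  univ_sets := by
    obtain ⟨i⟩ := F.inhabited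
    exact ⟨i, Set.subset_univ _⟩
  sets_of_superset := by
    rintro A B ⟨i, hi⟩ hAB
    exact ⟨i, hi.trans hAB⟩
  inter_sets := by
    rintro A B ⟨i, hi⟩ ⟨j, hj⟩
    obtain ⟨k, hk⟩ := F.directed i j
    exact ⟨k, fun u hu => ⟨hi (hk hu).1, hj (hk hu).2⟩⟩

theorem FilterObj.mem_gen {F : FilterObj.{u}} {A : Set F.carrier} :
    A ∈ F.gen ↔ ∃ i, F.base i ⊆ A := Iff.rfl

theorem FilterObj.eventually_base (F : FilterObj.{u}) (i : F.Idx) :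
    ∀ᶠ u in F.gen, u ∈ F.base i := ⟨i, subset_rfl⟩

/-- A continuous partial map `F → G`: a map defined on some base set of `F`, such that the
preimage of every base set of `G` contains a base set of `F`. -/
structure Cont (F G : FilterObj.{u}) where
  dom : F.Idx
  toFun : F.base dom → G.carrier
  cont : ∀ j, ∃ i, F.base i ⊆ {u | ∃ h : u ∈ F.base dom, toFun ⟨u, h⟩ ∈ G.base j}

namespace Cont

variable {F G H : FilterObj.{u}}

/-- The graph of a continuous partial map. -/
def Maps (a : Cont F G) (x : F.carrier) (y : G.carrier) : Prop :=
  ∃ h : x ∈ F.base a.dom, a.toFun ⟨x, h⟩ = y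

/-- Two continuous partial maps are equivalent if they agree on some base set. -/
def Equivalent (a b : Cont F G) : Prop :=
  ∃ k, F.base k ⊆ F.base a.dom ∩ F.base b.dom ∧
    ∀ (x : F.carrier) (_ : x ∈ F.base k) (ha : x ∈ F.base a.dom) (hb : x ∈ F.base b.dom),
      a.toFun ⟨x, ha⟩ = b.toFun ⟨x, hb⟩

theorem Maps.unique {a : Cont F G} {x : F.carrier} {y z : G.carrier}
    (h : a.Maps x y) (h2 : a.Maps x z) : y = z := by
  obtain ⟨_, rfl⟩ := h
  obtain ⟨_, rfl⟩ := h2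
  rfl

theorem equivalent_iff {a b : Cont F G} :
    a.Equivalent b ↔ ∀ᶠ x in F.gen, ∃ y, a.Maps x y ∧ b.Maps x y := by
  constructor
  · rintro ⟨k, hk, h⟩
    exact ⟨k, fun x hx => ⟨_, ⟨(hk hx).1, rfl⟩, ⟨(hk hx).2, (h x hx _ _).symm⟩⟩⟩
  · rintro ⟨k, hk⟩
    refine ⟨k, fun x hx => ?_, fun x hx ha hb => ?_⟩
    · obtain ⟨y, h1, h2⟩ := hk hx
      exact ⟨h1.1, h2.1⟩
    · obtain ⟨y, ⟨_, h1⟩, ⟨_, h2⟩⟩ := hk hx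
      exact h1.trans h2.symm

theorem eventually_maps (a : Cont F G) {P : G.carrier → Prop} (hP : ∀ᶠ y in G.gen, P y) :
    ∀ᶠ x in F.gen, ∃ y, P y ∧ a.Maps x y := by
  obtain ⟨j, hj⟩ := hP
  obtain ⟨i, hi⟩ := a.cont j
  refine ⟨i, fun x hx => ?_⟩
  obtain ⟨h, h2⟩ := hi hx
  exact ⟨_, hj h2, h, rfl⟩

theorem eventually_defined (a : Cont F G) : ∀ᶠ x in F.gen, ∃ y, a.Maps x y :=
  (a.eventually_maps (P := fun _ => True) (Eventually.of_forall fun _ => trivial)).mono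
    fun _ ⟨y, _, h⟩ => ⟨y, h⟩

instance setoid (F G : FilterObj.{u}) : Setoid (Cont F G) where
  r := Equivalent
  iseqv :=
    { refl := fun a => equivalent_iff.2 (a.eventually_defined.mono fun _ ⟨y, h⟩ => ⟨y, h, h⟩)
      symm := fun h => equivalent_iff.2
        ((equivalent_iff.1 h).mono fun _ ⟨y, h1, h2⟩ => ⟨y, h2, h1⟩)
      trans := fun {a b c} h h2 => equivalent_iff.2 (by
        filter_upwards [equivalent_iff.1 h, equivalent_iff.1 h2]
        rintro x ⟨y, h1, h2⟩ ⟨z, h3, h4⟩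
        exact ⟨y, h1, (h2.unique h3) ▸ h4⟩) }

theorem eqv_iff {a b : Cont F G} :
    a ≈ b ↔ ∀ᶠ x in F.gen, ∃ y, a.Maps x y ∧ b.Maps x y := equivalent_iff

/-- A total map that is continuous. -/
noncomputable def ofFun (f : F.carrier → G.carrier)
    (hf : ∀ j, ∃ i, F.base i ⊆ f ⁻¹' G.base j) : Cont F G where
  dom := F.inhabited.some
  toFun x := f x.1
  cont j := by
    obtain ⟨i, hi⟩ := hf j
    obtain ⟨k, hk⟩ := F.directed i F.inhabited.some
    exact ⟨k, fun x hx => ⟨(hk hx).2, hi (hk hx).1⟩⟩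

theorem ofFun_maps {f : F.carrier → G.carrier} {hf} {x : F.carrier} {y : G.carrier}
    (h : (ofFun f hf : Cont F G).Maps x y) : f x = y := h.2

theorem ofFun_eventually (f : F.carrier → G.carrier) (hf) :
    ∀ᶠ x in F.gen, (ofFun f hf : Cont F G).Maps x (f x) :=
  ⟨F.inhabited.some, fun _ hx => ⟨hx, rfl⟩⟩

/-- The identity. -/
noncomputable def id (F : FilterObj.{u}) : Cont F F :=
  ofFun (fun x => x) fun j => ⟨j, subset_rfl⟩

/-- Composition of continuous partial maps, defined on a base set on which it makes sense. -/
noncomputable def comp (a : Cont F G) (b : Cont G H) : Cont F H where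
  dom := (a.cont b.dom).choose
  toFun x := b.toFun ⟨_, ((a.cont b.dom).choose_spec x.2).choose_spec⟩
  cont j := by
    obtain ⟨i, hi⟩ : {y | ∃ h : y ∈ G.base b.dom, b.toFun ⟨y, h⟩ ∈ H.base j} ∈ G.gen := b.cont j
    obtain ⟨k, hk⟩ := a.cont i
    obtain ⟨l, hl⟩ := F.directed k (a.cont b.dom).choose
    refine ⟨l, fun x hx => ⟨(hl hx).2, ?_⟩⟩
    obtain ⟨h, h2⟩ := hk (hl hx).1
    exact (hi h2).2

theorem comp_maps {a : Cont F G} {b : Cont G H} {x : F.carrier} {z : H.carrier}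
    (h : (a.comp b).Maps x z) : ∃ y, a.Maps x y ∧ b.Maps y z := by
  obtain ⟨h, rfl⟩ := h
  exact ⟨_, ⟨_, rfl⟩, ⟨_, rfl⟩⟩

theorem comp_eqv {a a' : Cont F G} {b b' : Cont G H} (h : a ≈ a') (h2 : b ≈ b') :
    a.comp b ≈ a'.comp b' := by
  rw [eqv_iff] at *
  filter_upwards [h, a.eventually_maps h2, (a.comp b).eventually_defined,
    (a'.comp b').eventually_defined]
  rintro x ⟨y, h1, h2⟩ ⟨y', ⟨z, h3, h4⟩, h5⟩ ⟨s, hs⟩ ⟨t, ht⟩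
  obtain ⟨p, hp, hp2⟩ := comp_maps hs
  obtain ⟨q, hq, hq2⟩ := comp_maps ht
  obtain rfl := h1.unique h5
  obtain rfl := h1.unique hp
  obtain rfl := h2.unique hq
  obtain rfl := h3.unique hp2
  obtain rfl := h4.unique hq2
  exact ⟨_, hs, ht⟩

theorem comp_eventually (a : Cont F G) (b : Cont G H) :
    ∀ᶠ x in F.gen, ∃ y z, a.Maps x y ∧ b.Maps y z ∧ (a.comp b).Maps x z :=
  (a.comp b).eventually_defined.mono fun _ ⟨z, hz⟩ => by
    obtain ⟨y, h1, h2⟩ := comp_maps hz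
    exact ⟨y, z, h1, h2, hz⟩

/-- A continuous partial map from an eventually functional and continuous relation. -/
theorem exists_of_rel (R : F.carrier → G.carrier → Prop)
    (hc : ∀ j, ∀ᶠ x in F.gen, ∃ y ∈ G.base j, R x y)
    (hf : ∀ x y z, R x y → R x z → y = z) :
    ∃ a : Cont F G, ∀ x y, a.Maps x y → R x y := by
  obtain ⟨j0⟩ := G.inhabited
  obtain ⟨i, hi⟩ := hc j0
  have hi' : ∀ x : F.base i, ∃ y, R x.1 y := fun x => by
    obtain ⟨y, _, hy⟩ := hi x.2
    exact ⟨y, hy⟩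
  choose f hfR using hi'
  refine ⟨⟨i, f, fun j => ?_⟩, ?_⟩
  · obtain ⟨k, hk⟩ := (hc j).and (F.eventually_base i)
    refine ⟨k, fun x hx => ⟨(hk hx).2, ?_⟩⟩
    obtain ⟨y, hy, hR⟩ := (hk hx).1
    rw [hf _ _ _ (hfR ⟨x, (hk hx).2⟩) hR]
    exact hy
  · rintro x _ ⟨h, rfl⟩
    exact hfR ⟨x, h⟩

end Cont

/-- The category of filters: morphisms are germs of continuous partial maps. -/
noncomputable instance : Category.{u} FilterObj.{u} where
  Hom F G := Quotient (Cont.setoid F G)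
  id F := Quotient.mk _ (Cont.id F)
  comp f g := Quotient.map₂ Cont.comp (fun _ _ h _ _ h2 => Cont.comp_eqv h h2) f g
  id_comp f := by
    induction f using Quotient.inductionOn with | _ a => ?_
    refine Quotient.sound (Cont.eqv_iff.2 ?_)
    filter_upwards [Cont.comp_eventually (Cont.id _) a]
    rintro x ⟨y, z, h1, h2, h3⟩
    obtain rfl := Cont.ofFun_maps h1
    exact ⟨z, h3, h2⟩
  comp_id f := by
    induction f using Quotient.inductionOn with | _ a => ?_
    refine Quotient.sound (Cont.eqv_iff.2 ?_)
    filter_upwards [Cont.comp_eventually a (Cont.id _)]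
    rintro x ⟨y, z, h1, h2, h3⟩
    obtain rfl := Cont.ofFun_maps h2
    exact ⟨_, h3, h1⟩
  assoc f g h := by
    induction f using Quotient.inductionOn with | _ a => ?_
    induction g using Quotient.inductionOn with | _ b => ?_
    induction h using Quotient.inductionOn with | _ c => ?_
    refine Quotient.sound (Cont.eqv_iff.2 ?_)
    filter_upwards [Cont.comp_eventually (a.comp b) c, Cont.comp_eventually a (b.comp c)]
    rintro x ⟨y, z, h1, h2, h3⟩ ⟨y', z', h1', h2', h3'⟩
    obtain ⟨p, hp, hp2⟩ := Cont.comp_maps h1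
    obtain ⟨q, hq, hq2⟩ := Cont.comp_maps h2'
    obtain rfl := hp.unique h1'
    obtain rfl := hp2.unique hq
    obtain rfl := h2.unique hq2
    exact ⟨_, h3, h3'⟩

/-- The germ of a continuous partial map. -/
def germ {F G : FilterObj.{u}} (a : Cont F G) : F ⟶ G := Quotient.mk _ a

theorem germ_surj {F G : FilterObj.{u}} (f : F ⟶ G) : ∃ a, germ a = f := Quotient.exists_rep f

theorem germ_eq {F G : FilterObj.{u}} {a b : Cont F G} :
    germ a = germ b ↔ ∀ᶠ x in F.gen, ∃ y, a.Maps x y ∧ b.Maps x y :=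
  Quotient.eq.trans Cont.eqv_iff

theorem germ_comp {F G H : FilterObj.{u}} (a : Cont F G) (b : Cont G H) :
    germ a ≫ germ b = germ (a.comp b) := rfl

/-- A set, seen as a filter with itself as the only base set. -/
def simple (X : Type u) : FilterObj.{u} where
  carrier := X
  Idx := PUnit
  base _ := Set.univ
  inhabited := ⟨PUnit.unit⟩
  directed _ _ := ⟨PUnit.unit, by simp⟩

/-- A map of sets, seen as a morphism of filters. -/
noncomputable def simpleMap {X Y : Type u} (f : X → Y) : simple X ⟶ simple Y :=
  germ (Cont.ofFun (F := simple X) (G := simple Y) f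
    fun _ => ⟨PUnit.unit, fun _ _ => Set.mem_univ _⟩)

/-! ### The topology of finite covers -/

/-- A family of morphisms into `F` is a cover if the images of any choice of base sets of the
domains together contain a base set of `F`. (This does not depend on representatives.) -/
def IsKCover {F : FilterObj.{u}} {ι : Type} (G : ι → FilterObj.{u}) (β : ∀ k, G k ⟶ F) : Prop :=
  ∀ b : ∀ k, Cont (G k) F, (∀ k, germ (b k) = β k) → ∀ j : ∀ k, (G k).Idx,
    ∃ i, F.base i ⊆ ⋃ k, {x | ∃ y ∈ (G k).base (j k), (b k).Maps y x}

theorem IsKCover.eventually {F : FilterObj.{u}} {ι : Type} {G : ι → FilterObj.{u}}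
    {b : ∀ k, Cont (G k) F} (h : IsKCover G fun k => germ (b k))
    {P : ∀ k, (G k).carrier → Prop} (hP : ∀ k, ∀ᶠ y in (G k).gen, P k y) :
    ∀ᶠ x in F.gen, ∃ k y, P k y ∧ (b k).Maps y x := by
  choose j hj using hP
  obtain ⟨i, hi⟩ := h b (fun _ => rfl) j
  refine ⟨i, fun x hx => ?_⟩
  obtain ⟨k, y, hy, hb⟩ := Set.mem_iUnion.1 (hi hx)
  exact ⟨k, y, hj k hy, hb⟩

theorem isKCover_of_eventually {F : FilterObj.{u}} {ι : Type} {G : ι → FilterObj.{u}}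
    (b : ∀ k, Cont (G k) F)
    (h : ∀ P : ∀ k, (G k).carrier → Prop, (∀ k, ∀ᶠ y in (G k).gen, P k y) →
      ∀ᶠ x in F.gen, ∃ k y, P k y ∧ (b k).Maps y x) :
    IsKCover G fun k => germ (b k) := by
  intro c hc j
  obtain ⟨i, hi⟩ := h (fun k y => y ∈ (G k).base (j k) ∧ ∃ x, (c k).Maps y x ∧ (b k).Maps y x)
    fun k => ((G k).eventually_base (j k)).and (germ_eq.1 (hc k))
  refine ⟨i, fun x hx => ?_⟩
  obtain ⟨k, y, ⟨hy, x', h1, h2⟩, h3⟩ := hi hx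
  obtain rfl := h2.unique h3
  exact Set.mem_iUnion.2 ⟨k, y, hy, h1⟩

/-- The fibre product of two filters over a third one. -/
def pb {F G H : FilterObj.{u}} (a : Cont G F) (b : Cont H F) : FilterObj.{u} where
  carrier := G.carrier × H.carrier
  Idx := G.Idx × H.Idx
  base i := {p | p.1 ∈ G.base i.1 ∧ p.2 ∈ H.base i.2 ∧ ∃ x, a.Maps p.1 x ∧ b.Maps p.2 x}
  inhabited := ⟨(G.inhabited.some, H.inhabited.some)⟩
  directed i j := by
    obtain ⟨k, hk⟩ := G.directed i.1 j.1
    obtain ⟨l, hl⟩ := H.directed i.2 j.2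
    exact ⟨(k, l), fun p hp => ⟨⟨(hk hp.1).1, (hl hp.2.1).1, hp.2.2⟩,
      ⟨(hk hp.1).2, (hl hp.2.1).2, hp.2.2⟩⟩⟩

/-- First projection of the fibre product. -/
noncomputable def pbFst {F G H : FilterObj.{u}} (a : Cont G F) (b : Cont H F) :
    Cont (pb a b) G :=
  Cont.ofFun (F := pb a b) Prod.fst fun j => ⟨(j, H.inhabited.some), fun _ hp => hp.1⟩

/-- Second projection of the fibre product. -/
noncomputable def pbSnd {F G H : FilterObj.{u}} (a : Cont G F) (b : Cont H F) :
    Cont (pb a b) H :=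
  Cont.ofFun (F := pb a b) Prod.snd fun j => ⟨(G.inhabited.some, j), fun _ hp => hp.2.1⟩

theorem pb_comm {F G H : FilterObj.{u}} (a : Cont G F) (b : Cont H F) :
    germ (pbFst a b) ≫ germ a = germ (pbSnd a b) ≫ germ b := by
  rw [germ_comp, germ_comp, germ_eq]
  filter_upwards [Cont.comp_eventually (pbFst a b) a, Cont.comp_eventually (pbSnd a b) b,
    (pb a b).eventually_base (pb a b).inhabited.some]
  rintro p ⟨y, z, h1, h2, h3⟩ ⟨y', z', h1', h2', h3'⟩ ⟨_, _, x, hx, hx'⟩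
  obtain rfl := Cont.ofFun_maps h1
  obtain rfl := Cont.ofFun_maps h1'
  obtain rfl := h2.unique hx
  obtain rfl := h2'.unique hx'
  exact ⟨_, h3, h3'⟩

theorem IsKCover.pullback {F H : FilterObj.{u}} {ι : Type} [Finite ι] {G : ι → FilterObj.{u}}
    {b : ∀ k, Cont (G k) F} (h : IsKCover G fun k => germ (b k)) (a : Cont H F) :
    IsKCover (fun k => pb (b k) a) fun k => germ (pbSnd (b k) a) := by
  apply isKCover_of_eventually
  intro P hP
  choose j hj using hP
  have h1 := a.eventually_maps (h.eventually fun k => (G k).eventually_base (j k).1)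
  have h2 : ∀ᶠ x in H.gen, ∀ k, x ∈ H.base (j k).2 :=
    eventually_all.2 fun k => H.eventually_base (j k).2
  have h3 : ∀ᶠ x in H.gen, ∀ k, x ∈ H.base (pb (b k) a).inhabited.some.2 :=
    eventually_all.2 fun k => H.eventually_base _
  have h4 := a.eventually_maps
    (h.eventually fun k => ((G k).eventually_base (j k).1).and
      ((G k).eventually_base (pb (b k) a).inhabited.some.1))
  filter_upwards [h4, h2, h3]
  rintro x ⟨y, ⟨k, z, ⟨hz, hz'⟩, hb⟩, hy⟩ hx hx'
  exact ⟨k, (z, x), hj k ⟨hz, hx k, y, hb, hy⟩, ⟨⟨hz', hx' k, y, hb, hy⟩, rfl⟩⟩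

/-- The Grothendieck topology on the category of filters in which a sieve is covering iff it
contains a finite cover. -/
def K : GrothendieckTopology FilterObj.{u} where
  sieves F := {S | ∃ (ι : Type) (_ : Finite ι) (G : ι → FilterObj.{u}) (β : ∀ k, G k ⟶ F),
    IsKCover G β ∧ ∀ k, S (β k)}
  top_mem' F := by
    refine ⟨Unit, inferInstance, fun _ => F, fun _ => germ (Cont.id F), ?_, fun _ => trivial⟩
    apply isKCover_of_eventually
    intro P hP
    filter_upwards [hP (), Cont.ofFun_eventually (F := F) (G := F) (fun x => x)
      fun j => ⟨j, subset_rfl⟩] with x hx hx2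
    exact ⟨(), x, hx, hx2⟩
  pullback_stable' := by
    rintro F H S f ⟨ι, hι, G, β, h, hS⟩
    choose b hb using fun k => germ_surj (β k)
    obtain rfl : (fun k => germ (b k)) = β := funext hb
    obtain ⟨a, rfl⟩ := germ_surj f
    refine ⟨ι, hι, _, _, h.pullback a, fun k => ?_⟩
    change S (germ (pbSnd (b k) a) ≫ germ a)
    rw [← pb_comm]
    exact S.downward_closed (hS k) _
  transitive' := by
    rintro F S ⟨ι, hι, G, β, h, hS⟩ R hR
    choose b hb using fun k => germ_surj (β k)
    obtain rfl : (fun k => germ (b k)) = β := funext hb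
    choose κ hκ G' β' h' hR' using fun k => hR (hS k)
    choose b' hb' using fun k l => germ_surj (β' k l)
    obtain rfl : (fun k l => germ (b' k l)) = β' := funext fun k => funext (hb' k)
    refine ⟨Σ k, κ k, inferInstance, fun p => G' p.1 p.2,
      fun p => germ ((b' p.1 p.2).comp (b p.1)), ?_, fun p => hR' p.1 p.2⟩
    apply isKCover_of_eventually
    intro P hP
    have h1 := h.eventually fun k => (h' k).eventually fun l =>
      (hP ⟨k, l⟩).and (Cont.comp_eventually (b' k l) (b k))
    filter_upwards [h1]
    rintro x ⟨k, y, ⟨l, z, ⟨hz, y', x', h2, h3, h4⟩, h5⟩, h6⟩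
    obtain rfl := h2.unique h5
    obtain rfl := h3.unique h6
    exact ⟨⟨k, l⟩, z, hz, h4⟩

theorem hom_ext_of_isKCover {F X : FilterObj.{u}} {ι : Type} {G : ι → FilterObj.{u}}
    {β : ∀ k, G k ⟶ F} (h : IsKCover G β) {f g : F ⟶ X} (hfg : ∀ k, β k ≫ f = β k ≫ g) :
    f = g := by
  choose b hb using fun k => germ_surj (β k)
  obtain rfl : (fun k => germ (b k)) = β := funext hb
  obtain ⟨a, rfl⟩ := germ_surj f
  obtain ⟨c, rfl⟩ := germ_surj g
  rw [germ_eq]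
  have h1 := h.eventually fun k => germ_eq.1 (hfg k)
  filter_upwards [h1]
  rintro x ⟨k, y, ⟨z, h2, h3⟩, h4⟩
  obtain ⟨p, hp, hp2⟩ := Cont.comp_maps h2
  obtain ⟨q, hq, hq2⟩ := Cont.comp_maps h3
  obtain rfl := hp.unique h4
  obtain rfl := hq.unique h4
  exact ⟨z, hp2, hq2⟩

theorem glue_of_isKCover {F X : FilterObj.{u}} {ι : Type} [Finite ι] {G : ι → FilterObj.{u}}
    {β : ∀ k, G k ⟶ F} (h : IsKCover G β) (ξ : ∀ k, G k ⟶ X)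
    (hξ : ∀ k l (H : FilterObj.{u}) (p : H ⟶ G k) (q : H ⟶ G l),
      p ≫ β k = q ≫ β l → p ≫ ξ k = q ≫ ξ l) :
    ∃ f : F ⟶ X, ∀ k, β k ≫ f = ξ k := by
  choose b hb using fun k => germ_surj (β k)
  obtain rfl : (fun k => germ (b k)) = β := funext hb
  choose c hc using fun k => germ_surj (ξ k)
  obtain rfl : (fun k => germ (c k)) = ξ := funext hc
  have key : ∀ k l, ∃ i : (G k).Idx × (G l).Idx, ∀ y ∈ (G k).base i.1, ∀ z ∈ (G l).base i.2,
      ∀ x, (b k).Maps y x → (b l).Maps z x → ∃ t, (c k).Maps y t ∧ (c l).Maps z t := by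
    intro k l
    have h1 := germ_eq.1 (hξ k l _ _ _ (pb_comm (b k) (b l)))
    obtain ⟨i, hi⟩ := h1
    refine ⟨i, fun y hy z hz x hyx hzx => ?_⟩
    obtain ⟨t, h2, h3⟩ := hi (show (y, z) ∈ (pb (b k) (b l)).base i from ⟨hy, hz, x, hyx, hzx⟩)
    obtain ⟨p, hp, hp2⟩ := Cont.comp_maps h2
    obtain ⟨q, hq, hq2⟩ := Cont.comp_maps h3
    obtain rfl := Cont.ofFun_maps hp
    obtain rfl := Cont.ofFun_maps hq
    exact ⟨t, hp2, hq2⟩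
  choose i hi using key
  let A : ∀ k, (G k).carrier → Prop := fun k y =>
    ∀ l, y ∈ (G k).base (i k l).1 ∧ y ∈ (G k).base (i l k).2
  have hA : ∀ k, ∀ᶠ y in (G k).gen, A k y := fun k =>
    eventually_all.2 fun l => ((G k).eventually_base _).and ((G k).eventually_base _)
  let R : F.carrier → X.carrier → Prop := fun x t =>
    ∃ k y, A k y ∧ (b k).Maps y x ∧ (c k).Maps y t
  have hR : ∀ x s t, R x s → R x t → s = t := by
    rintro x s t ⟨k, y, hy, h1, h2⟩ ⟨l, z, hz, h3, h4⟩
    obtain ⟨r, h5, h6⟩ := hi k l y (hy l).1 z (hz k).2 x h1 h3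
    rw [h2.unique h5, h4.unique h6]
  obtain ⟨a, ha⟩ := Cont.exists_of_rel R (fun j => by
    filter_upwards [h.eventually fun k => (hA k).and
      ((c k).eventually_maps (X.eventually_base j))]
    rintro x ⟨k, y, ⟨hy, t, ht, hc⟩, hb⟩
    exact ⟨t, ht, k, y, hy, hb, hc⟩) hR
  refine ⟨germ a, fun k => ?_⟩
  rw [germ_comp, germ_eq]
  filter_upwards [Cont.comp_eventually (b k) a, hA k, (c k).eventually_defined]
  rintro y ⟨x, t, h1, h2, h3⟩ hy ⟨s, hs⟩
  obtain rfl := hR x t s (ha _ _ h2) ⟨k, y, hy, h1, hs⟩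
  exact ⟨t, h3, hs⟩

instance K_subcanonical : K.{u}.Subcanonical := by
  apply GrothendieckTopology.Subcanonical.of_isSheaf_yoneda_obj
  rintro X F S ⟨ι, hι, G, β, h, hS⟩ x hx
  obtain ⟨f, hf⟩ := glue_of_isKCover (X := X) h (fun k => x (β k) (hS k))
    fun k l H p q e => hx p q (hS k) (hS l) e
  refine ⟨f, fun H g hg => ?_, fun f' hf' => ?_⟩
  · choose b hb using fun k => germ_surj (β k)
    obtain rfl : (fun k => germ (b k)) = β := funext hb
    obtain ⟨a, rfl⟩ := germ_surj g
    refine hom_ext_of_isKCover (h.pullback a) fun k => ?_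
    have h1 := hx (germ (pbFst (b k) a)) (germ (pbSnd (b k) a)) (hS k) hg (pb_comm (b k) a)
    replace h1 : germ (pbFst (b k) a) ≫ x (germ (b k)) (hS k) =
      germ (pbSnd (b k) a) ≫ x (germ a) hg := h1
    change germ (pbSnd (b k) a) ≫ germ a ≫ f = germ (pbSnd (b k) a) ≫ x (germ a) hg
    rw [← h1, ← hf k, ← Category.assoc, ← pb_comm, Category.assoc]
  · refine hom_ext_of_isKCover h fun k => ?_
    exact (hf' _ (hS k)).trans (hf k).symm

/-- The filter topos: sheaves on the category of filters for the topology of finite covers.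
The site is small relative to `Type (u + 1)`. -/
abbrev N : Type (u + 2) := Sheaf K.{u} (Type (u + 1))

/-- The Yoneda embedding of the category of filters in the filter topos. -/
noncomputable def yon : FilterObj.{u} ⥤ N.{u} := GrothendieckTopology.uliftYoneda.{u + 1} K.{u}

/-- The representable sheaf on a set. -/
noncomputable abbrev ySet (X : Type u) : N.{u} := yon.obj (simple X)

/-- The morphism of representable sheaves induced by a map of sets. -/
noncomputable abbrev yMap {X Y : Type u} (f : X → Y) : ySet X ⟶ ySet Y := yon.map (simpleMap f)

/-! ### Subobjects in the filter topos -/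

theorem N.isSheaf (X : N.{u}) : Presieve.IsSheaf K X.obj :=
  (isSheaf_iff_isSheaf_of_type _ _).1 X.property

/-- A subobject of an object of the filter topos: a subfunctor that is a sheaf. -/
@[ext]
structure Subsheaf (X : N.{u}) where
  sub : Subfunctor X.obj
  isSheaf : Presieve.IsSheaf K sub.toFunctor

theorem isSheaf_of_local {X : N.{u}} (A : Subfunctor X.obj)
    (h : ∀ (U : FilterObj.{u}) (s : X.obj.obj (op U)) (S : Sieve U), S ∈ K U →
      (∀ (V : FilterObj.{u}) (f : V ⟶ U), S f → X.obj.map f.op s ∈ A.obj (op V)) →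
      s ∈ A.obj (op U)) :
    Presieve.IsSheaf K A.toFunctor :=
  (A.isSheaf_iff X.isSheaf).2 fun U s hs => h U.unop s _ hs fun _ _ hf => hf

namespace Subsheaf

variable {X Y : N.{u}}

noncomputable instance : PartialOrder (Subsheaf X) := PartialOrder.lift Subsheaf.sub fun _ _ => Subsheaf.ext

theorem le_iff {A B : Subsheaf X} :
    A ≤ B ↔ ∀ (U : FilterObj.{u}ᵒᵖ) (s : X.obj.obj U), s ∈ A.sub.obj U → s ∈ B.sub.obj U :=
  Iff.rfl

theorem mem_of_local (A : Subsheaf X) {U : FilterObj.{u}} {s : X.obj.obj (op U)} (S : Sieve U)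
    (hS : S ∈ K U)
    (h : ∀ (V : FilterObj.{u}) (f : V ⟶ U), S f → X.obj.map f.op s ∈ A.sub.obj (op V)) :
    s ∈ A.sub.obj (op U) :=
  (A.sub.isSheaf_iff X.isSheaf).1 A.isSheaf (op U) s (K.superset_covering h hS)

/-- The subsheaf generated by a subfunctor. -/
noncomputable def ofSub (A : Subfunctor X.obj) : Subsheaf X :=
  ⟨A.sheafify K, A.sheafify_isSheaf X.isSheaf⟩

theorem ofSub_le {A : Subfunctor X.obj} {B : Subsheaf X} : ofSub A ≤ B ↔ A ≤ B.sub :=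
  ⟨fun h => (A.le_sheafify K).trans h, fun h => A.sheafify_le _ h X.isSheaf B.isSheaf⟩

/-- The whole sheaf. -/
noncomputable instance : Top (Subsheaf X) := ⟨⟨⊤, isSheaf_of_local _ fun _ _ _ _ _ => trivial⟩⟩

/-- The least subsheaf. -/
noncomputable instance : Bot (Subsheaf X) := ⟨ofSub ⊥⟩

/-- Intersection. -/
noncomputable def inter (A B : Subsheaf X) : Subsheaf X where
  sub := A.sub ⊓ B.sub
  isSheaf := isSheaf_of_local _ fun _ _ S hS h =>
    ⟨A.mem_of_local S hS fun V f hf => (h V f hf).1,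
      B.mem_of_local S hS fun V f hf => (h V f hf).2⟩

/-- Union. -/
noncomputable def union (A B : Subsheaf X) : Subsheaf X := ofSub (A.sub ⊔ B.sub)

/-- Heyting implication. -/
noncomputable def imp (A B : Subsheaf X) : Subsheaf X where
  sub :=
    { obj := fun U => {s | ∀ (V : FilterObj.{u}ᵒᵖ) (f : U ⟶ V),
        X.obj.map f s ∈ A.sub.obj V → X.obj.map f s ∈ B.sub.obj V}
      map := by
        intro U V f s hs W g h
        have e : X.obj.map g (X.obj.map f s) = X.obj.map (f ≫ g) s := by simp
        rw [e] at h ⊢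
        exact hs W _ h }
  isSheaf := isSheaf_of_local _ fun U s S hS h V f hA => by
    refine B.mem_of_local (U := V.unop) _ (K.pullback_stable f.unop hS) fun W g hg => ?_
    have h1 := h W (g ≫ f.unop) hg (op W) (𝟙 _)
    have e : X.obj.map g.op (X.obj.map f s) = X.obj.map (g ≫ f.unop).op s := by simp
    rw [Functor.map_id_apply, ← e] at h1
    exact h1 (A.sub.map g.op hA)

/-- Inverse image. -/
noncomputable def pullback (f : X ⟶ Y) (B : Subsheaf Y) : Subsheaf X where
  sub := B.sub.preimage f.hom
  isSheaf := isSheaf_of_local _ fun U s S hS h => by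
    refine B.mem_of_local S hS fun V g hg => ?_
    have h1 : f.hom.app _ (X.obj.map g.op s) ∈ B.sub.obj (op V) := h V g hg
    rwa [NatTrans.naturality_apply] at h1

/-- Existential quantification along a morphism: the direct image. -/
noncomputable def ex (f : X ⟶ Y) (A : Subsheaf X) : Subsheaf Y := ofSub (A.sub.image f.hom)

/-- Universal quantification along a morphism. -/
noncomputable def all (f : X ⟶ Y) (A : Subsheaf X) : Subsheaf Y where
  sub :=
    { obj := fun U => {s | ∀ (V : FilterObj.{u}ᵒᵖ) (g : U ⟶ V) (t : X.obj.obj V),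
        f.hom.app V t = Y.obj.map g s → t ∈ A.sub.obj V}
      map := by
        intro U V g s hs W g' t h
        refine hs W (g ≫ g') t (h.trans ?_)
        simp }
  isSheaf := isSheaf_of_local _ fun U s S hS h V g t ht => by
    refine A.mem_of_local (U := V.unop) _ (K.pullback_stable g.unop hS) fun W k hk => ?_
    refine h W (k ≫ g.unop) hk (op W) (𝟙 _) _ ?_
    rw [Functor.map_id_apply, NatTrans.naturality_apply]
    refine (congrArg (Y.obj.map k.op) ht).trans ?_
    simp

/-! The following facts characterise the operations above by adjunctions: the subobjects of each
object form a Heyting algebra, in which the quantifiers are the adjoints of the inverse image. -/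

theorem le_top (A : Subsheaf X) : A ≤ ⊤ := fun _ _ _ => trivial

theorem bot_le (A : Subsheaf X) : ⊥ ≤ A := ofSub_le.2 fun _ _ h => h.elim

theorem le_inter {A B C : Subsheaf X} : C ≤ inter A B ↔ C ≤ A ∧ C ≤ B :=
  le_inf_iff (α := Subfunctor X.obj)

theorem union_le {A B C : Subsheaf X} : union A B ≤ C ↔ A ≤ C ∧ B ≤ C :=
  ofSub_le.trans sup_le_iff

theorem le_imp {A B C : Subsheaf X} : C ≤ imp A B ↔ inter C A ≤ B := by
  constructor
  · rintro h U s ⟨hC, hA⟩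
    have h1 := h U hC U (𝟙 U)
    rw [Functor.map_id_apply] at h1
    exact h1 hA
  · exact fun h U s hC V f hA => h V ⟨C.sub.map f hC, hA⟩

theorem ex_le {f : X ⟶ Y} {A : Subsheaf X} {B : Subsheaf Y} :
    ex f A ≤ B ↔ A ≤ pullback f B :=
  ofSub_le.trans (Subfunctor.image_le_iff _ _ _)

theorem le_all {f : X ⟶ Y} {A : Subsheaf X} {B : Subsheaf Y} :
    B ≤ all f A ↔ pullback f B ≤ A := by
  constructor
  · intro h U t ht
    exact h U ht U (𝟙 U) t (Functor.map_id_apply Y.obj U _).symm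
  · intro h U s hs V g t ht
    refine h V (show f.hom.app V t ∈ B.sub.obj V from ?_)
    rw [ht]
    exact B.sub.map g hs

end Subsheaf

/-! ### The basic subobjects -/

/-- Restriction of sections of a representable sheaf is composition. -/
theorem ySet_map {X : Type u} {U V : FilterObj.{u}} (f : V ⟶ U)
    (s : (ySet X).obj.obj (op U)) : ((ySet X).obj.map f.op s).down = f ≫ s.down := rfl

theorem yMap_app {X Y : Type u} (f : X → Y) {U : FilterObj.{u}}
    (s : (ySet X).obj.obj (op U)) :
    ((yMap f).hom.app (op U) s).down = s.down ≫ simpleMap f := rfl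

theorem exists_germ_of_eventually {U : FilterObj.{u}} {X : Type u} {a : Cont U (simple X)}
    {A : Set X} (h : ∀ᶠ x in U.gen, ∃ v ∈ A, a.Maps x v) :
    ∃ b : Cont U (simple X), germ b = germ a ∧ ∀ x v, b.Maps x v → v ∈ A := by
  obtain ⟨b, hb⟩ := Cont.exists_of_rel (F := U) (G := simple X)
    (fun x v => v ∈ A ∧ a.Maps x v)
    (fun j => h.mono fun x ⟨v, hv, hx⟩ => ⟨v, trivial, hv, hx⟩)
    fun x _ _ h1 h2 => h1.2.unique h2.2
  refine ⟨b, germ_eq.2 ?_, fun x v hx => (hb x v hx).1⟩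
  exact b.eventually_defined.mono fun x ⟨v, hv⟩ => ⟨v, hv, (hb x v hv).2⟩

theorem mem_range_incl {X : Type u} {A : Set X} {U : FilterObj.{u}} (a : Cont U (simple X)) :
    (ULift.up (germ a) : (ySet X).obj.obj (op U)) ∈
      (Subfunctor.range (yMap (Subtype.val : A → X)).hom).obj (op U) ↔
      ∀ᶠ x in U.gen, ∃ v ∈ A, a.Maps x v := by
  constructor
  · rintro ⟨⟨g⟩, hg⟩
    obtain ⟨b, rfl⟩ := germ_surj g
    have h1 : germ b ≫ simpleMap (Subtype.val : A → X) = germ a := congrArg ULift.down hg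
    filter_upwards [germ_eq.1 h1]
    rintro x ⟨v, h2, h3⟩
    obtain ⟨w, _, h4⟩ := Cont.comp_maps h2
    obtain rfl := Cont.ofFun_maps h4
    exact ⟨_, w.2, h3⟩
  · intro h
    obtain ⟨b, hb⟩ := Cont.exists_of_rel (F := U) (G := simple A)
      (fun x v => a.Maps x v.1) (fun j => h.mono fun x ⟨v, hv, hx⟩ => ⟨⟨v, hv⟩, trivial, hx⟩)
      fun x _ _ h1 h2 => Subtype.ext (h1.unique h2)
    refine ⟨ULift.up (germ b), congrArg ULift.up ?_⟩
    refine germ_eq.2 ((Cont.comp_eventually b (Cont.ofFun (F := simple A) (G := simple X)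
      Subtype.val fun _ => ⟨PUnit.unit, fun _ _ => Set.mem_univ _⟩)).mono ?_)
    rintro x ⟨v, w, h1, h2, h3⟩
    obtain rfl := Cont.ofFun_maps h2
    exact ⟨_, h3, hb _ _ h1⟩

/-- The subobject of a representable sheaf given by a subset: the representable sheaf on the
subset, embedded by the inclusion map. -/
noncomputable def ySub {X : Type u} (A : Set X) : Subsheaf (ySet X) where
  sub := Subfunctor.range (yMap (Subtype.val : A → X)).hom
  isSheaf := isSheaf_of_local _ fun U s S hS h => by
    obtain ⟨ι, hι, G, β, hK, hβ⟩ := hS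
    obtain ⟨s⟩ := s
    obtain ⟨a, rfl⟩ := germ_surj s
    choose b hb using fun k => germ_surj (β k)
    obtain rfl : (fun k => germ (b k)) = β := funext hb
    have h1 : ∀ k, ∀ᶠ x in (G k).gen, ∃ v ∈ A, ((b k).comp a).Maps x v :=
      fun k => (mem_range_incl _).1 (h _ _ (hβ k))
    refine (mem_range_incl a).2 ?_
    filter_upwards [hK.eventually h1]
    rintro x ⟨k, z, ⟨v, hv, hz⟩, hx⟩
    obtain ⟨p, h2, h3⟩ := Cont.comp_maps hz
    obtain rfl := h2.unique hx
    exact ⟨v, hv, h3⟩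

/-- A germ takes a finite number of values: it has a representative with finite range. -/
def FinitelyValued {U : FilterObj.{u}} {X : Type u} (s : U ⟶ simple X) : Prop :=
  ∃ a : Cont U (simple X), germ a = s ∧ (Set.range a.toFun).Finite

theorem finitelyValued_iff {U : FilterObj.{u}} {X : Type u} (a : Cont U (simple X)) :
    FinitelyValued (germ a) ↔
      ∃ A : Set X, A.Finite ∧ ∀ᶠ x in U.gen, ∃ v ∈ A, a.Maps x v := by
  constructor
  · rintro ⟨b, hb, hf⟩
    refine ⟨_, hf, (germ_eq.1 hb).mono ?_⟩
    rintro x ⟨v, ⟨h, rfl⟩, h2⟩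
    exact ⟨_, ⟨_, rfl⟩, h2⟩
  · rintro ⟨A, hA, h⟩
    obtain ⟨b, hb, hbA⟩ := exists_germ_of_eventually h
    refine ⟨b, hb, hA.subset ?_⟩
    rintro _ ⟨x, rfl⟩
    exact hbA x.1 _ ⟨x.2, rfl⟩

/-- The constant sheaf on a set, as a subobject of the representable sheaf: it consists of the
germs of maps that take a finite number of values. -/
noncomputable def stSub (X : Type u) : Subsheaf (ySet X) where
  sub :=
    { obj := fun U => {s | FinitelyValued s.down}
      map := by
        rintro U V f ⟨s⟩ hs
        obtain ⟨a, rfl⟩ := germ_surj s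
        obtain ⟨b, hb⟩ := germ_surj f.unop
        obtain ⟨A, hA, h⟩ := (finitelyValued_iff a).1 hs
        change FinitelyValued (f.unop ≫ germ a)
        rw [← hb, germ_comp, finitelyValued_iff]
        refine ⟨A, hA, ?_⟩
        filter_upwards [Cont.comp_eventually b a, b.eventually_maps h]
        rintro x ⟨p, v, h1, h2, h3⟩ ⟨q, ⟨w, hw, h4⟩, h5⟩
        obtain rfl := h1.unique h5
        obtain rfl := h2.unique h4
        exact ⟨_, hw, h3⟩ }
  isSheaf := isSheaf_of_local _ fun U s S hS h => by
    obtain ⟨ι, hι, G, β, hK, hβ⟩ := hS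
    obtain ⟨s⟩ := s
    obtain ⟨a, rfl⟩ := germ_surj s
    choose b hb using fun k => germ_surj (β k)
    obtain rfl : (fun k => germ (b k)) = β := funext hb
    choose A hA hAf using fun k => (finitelyValued_iff ((b k).comp a)).1 (h _ _ (hβ k))
    refine (finitelyValued_iff a).2 ⟨⋃ k, A k, Set.finite_iUnion hA, ?_⟩
    filter_upwards [hK.eventually hAf]
    rintro x ⟨k, z, ⟨v, hv, hz⟩, hx⟩
    obtain ⟨p, h2, h3⟩ := Cont.comp_maps hz
    obtain rfl := h2.unique hx
    exact ⟨v, Set.mem_iUnion.2 ⟨k, hv⟩, h3⟩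

/-! ### Many-sorted first-order languages with finite sequences and standardness -/

/-- A many-sorted first-order language whose types are closed under forming types of finite
sequences. Constants are function symbols without arguments. -/
structure Language where
  Ty : Type v
  seq : Ty → Ty
  Fn : List Ty → Ty → Type v
  Rel : List Ty → Type v

/-- Finite products of the interpretations of the types in a list. -/
def Env {T : Type v} (El : T → Type u) : List T → Type u
  | [] => PUnit
  | S :: Γ => El S × Env El Γ

/-- The element of a finite product with given components. -/
def Env.ofFn {T : Type v} {El : T → Type u} :
    (Γ : List T) → (∀ i : Fin Γ.length, El (Γ.get i)) → Env El Γ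
  | [], _ => PUnit.unit
  | _ :: Γ, g => (g 0, Env.ofFn Γ fun i => g i.succ)

/-- An interpretation of a language in sets, in which `seq S` is interpreted as the set of finite
sequences of elements of the interpretation of `S`. -/
structure Interpretation (L : Language.{v}) where
  El : L.Ty → Type u
  seqEquiv : ∀ S, El (L.seq S) ≃ List (El S)
  fn : ∀ {σ : List L.Ty} {S : L.Ty}, L.Fn σ S → Env El σ → El S
  rel : ∀ {σ : List L.Ty}, L.Rel σ → Set (Env El σ)

/-- Typed variables in a context, as de Bruijn indices. -/
inductive Var {T : Type v} : List T → T → Type v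
  | zero {Γ : List T} {S : T} : Var (S :: Γ) S
  | succ {Γ : List T} {S R : T} : Var Γ S → Var (R :: Γ) S

/-- Typed terms in a context. -/
inductive Term (L : Language.{v}) (Γ : List L.Ty) : L.Ty → Type v
  | var {S : L.Ty} : Var Γ S → Term L Γ S
  | app {σ : List L.Ty} {S : L.Ty} : L.Fn σ S → (∀ i : Fin σ.length, Term L Γ (σ.get i)) →
      Term L Γ S

/-- Formulae in a context, in the language extended with a standardness predicate for each type.
Equality and membership in a finite sequence are available at each type. -/
inductive Formula (L : Language.{v}) : List L.Ty → Type v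
  | rel {Γ σ : List L.Ty} : L.Rel σ → (∀ i : Fin σ.length, Term L Γ (σ.get i)) → Formula L Γ
  | eq {Γ : List L.Ty} {S : L.Ty} : Term L Γ S → Term L Γ S → Formula L Γ
  | mem {Γ : List L.Ty} {S : L.Ty} : Term L Γ S → Term L Γ (L.seq S) → Formula L Γ
  | st {Γ : List L.Ty} {S : L.Ty} : Term L Γ S → Formula L Γ
  | fls {Γ : List L.Ty} : Formula L Γ
  | and {Γ : List L.Ty} : Formula L Γ → Formula L Γ → Formula L Γ
  | or {Γ : List L.Ty} : Formula L Γ → Formula L Γ → Formula L Γ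
  | imp {Γ : List L.Ty} : Formula L Γ → Formula L Γ → Formula L Γ
  | all {Γ : List L.Ty} (S : L.Ty) : Formula L (S :: Γ) → Formula L Γ
  | ex {Γ : List L.Ty} (S : L.Ty) : Formula L (S :: Γ) → Formula L Γ

/-- A formula is internal if the standardness predicate does not occur in it. -/
def Formula.Internal {L : Language.{v}} : {Γ : List L.Ty} → Formula L Γ → Prop
  | _, .rel _ _ => True
  | _, .eq _ _ => True
  | _, .mem _ _ => True
  | _, .st _ => False
  | _, .fls => True
  | _, .and Φ Ψ => Φ.Internal ∧ Ψ.Internal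
  | _, .or Φ Ψ => Φ.Internal ∧ Ψ.Internal
  | _, .imp Φ Ψ => Φ.Internal ∧ Ψ.Internal
  | _, .all _ Φ => Φ.Internal
  | _, .ex _ Φ => Φ.Internal

/-! Renaming of variables, needed to put a formula under a new quantifier. -/

/-- A renaming of the variables of one context to variables of another. -/
abbrev Ren {T : Type v} (Γ Δ : List T) : Type v := ∀ S : T, Var Γ S → Var Δ S

/-- The extension of a renaming by a new variable, which is kept. -/
def Ren.lift {T : Type v} {Γ Δ : List T} (ρ : Ren Γ Δ) (R : T) : Ren (R :: Γ) (R :: Δ)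
  | _, .zero => .zero
  | _, .succ x => .succ (ρ _ x)

def Term.rename {L : Language.{v}} {Γ Δ : List L.Ty} (ρ : Ren Γ Δ) {S : L.Ty} :
    Term L Γ S → Term L Δ S
  | .var x => .var (ρ _ x)
  | .app f ts => .app f fun i => (ts i).rename ρ

def Formula.rename {L : Language.{v}} : {Γ Δ : List L.Ty} → Ren Γ Δ → Formula L Γ → Formula L Δ
  | _, _, ρ, .rel R ts => .rel R fun i => (ts i).rename ρ
  | _, _, ρ, .eq s t => .eq (s.rename ρ) (t.rename ρ)
  | _, _, ρ, .mem s t => .mem (s.rename ρ) (t.rename ρ)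
  | _, _, ρ, .st t => .st (t.rename ρ)
  | _, _, _, .fls => .fls
  | _, _, ρ, .and Φ Ψ => .and (Φ.rename ρ) (Ψ.rename ρ)
  | _, _, ρ, .or Φ Ψ => .or (Φ.rename ρ) (Ψ.rename ρ)
  | _, _, ρ, .imp Φ Ψ => .imp (Φ.rename ρ) (Ψ.rename ρ)
  | _, _, ρ, .all S Φ => .all S (Φ.rename (ρ.lift S))
  | _, _, ρ, .ex S Φ => .ex S (Φ.rename (ρ.lift S))

/-- A formula with a distinguished variable `x : S`, in a context with one more variable. -/
def Formula.weaken {L : Language.{v}} {Γ : List L.Ty} {S : L.Ty} (R : L.Ty)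
    (Φ : Formula L (S :: Γ)) : Formula L (S :: R :: Γ) :=
  Φ.rename (Ren.lift (fun _ x => .succ x) S)

/-- `∀ x : S, st x → Φ x`. -/
def Formula.allSt {L : Language.{v}} {Γ : List L.Ty} (S : L.Ty) (Φ : Formula L (S :: Γ)) :
    Formula L Γ :=
  .all S (.imp (.st (.var .zero)) Φ)

/-- `∃ x : S, st x ∧ Φ x`. -/
def Formula.exSt {L : Language.{v}} {Γ : List L.Ty} (S : L.Ty) (Φ : Formula L (S :: Γ)) :
    Formula L Γ :=
  .ex S (.and (.st (.var .zero)) Φ)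

/-- `∃ x : S, x ∈ t ∧ Φ x`, for a term `t` of type `seq S`. -/
def Formula.exMem {L : Language.{v}} {Γ : List L.Ty} {S : L.Ty} (t : Term L Γ (L.seq S))
    (Φ : Formula L (S :: Γ)) : Formula L Γ :=
  .ex S (.and (.mem (.var .zero) (t.rename fun _ x => .succ x)) Φ)

/-- The instance of the herbrandised independence of premise principle for `φ` and `Ψ`:
`(∀ˢᵗ x : S, φ x → ∃ˢᵗ y : T, Ψ y) → ∃ˢᵗ t : seq T, (∀ˢᵗ x : S, φ x → ∃ y ∈ t, Ψ y)`. -/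
def Formula.hip {L : Language.{v}} {Γ : List L.Ty} {S T : L.Ty}
    (φ : Formula L (S :: Γ)) (Ψ : Formula L (T :: Γ)) : Formula L Γ :=
  .imp (.imp (.allSt S φ) (.exSt T Ψ))
    (.exSt (L.seq T)
      (.imp (.allSt S (φ.weaken (L.seq T)))
        (.exMem (.var .zero) (Ψ.weaken (L.seq T)))))

/-! ### Interpretation in the filter topos -/

namespace Interpretation

variable {L : Language.{v}} (M : Interpretation.{u, v} L)

/-- The value of a variable. -/
def evalVar : {Γ : List L.Ty} → {S : L.Ty} → Var Γ S → Env M.El Γ → M.El S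
  | _, _, .zero, e => e.1
  | _, _, .succ x, e => evalVar x e.2

/-- The interpretation of a term in sets. -/
def eval {Γ : List L.Ty} : {S : L.Ty} → Term L Γ S → Env M.El Γ → M.El S
  | _, .var x, e => M.evalVar x e
  | _, .app f ts, e => M.fn f (Env.ofFn _ fun i => eval (ts i) e)

/-- The interpretation in the filter topos of a formula in context `Γ`, a subobject of the
representable sheaf on the product of the types in `Γ`. Types, terms, relation symbols, equality
and membership are interpreted by applying the Yoneda embedding to their interpretation in sets,
standardness by the constant sheaf, and connectives and quantifiers by the Heyting category
structure of the topos. -/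
noncomputable def sem : {Γ : List L.Ty} → Formula L Γ → Subsheaf (ySet (Env M.El Γ))
  | _, .rel R ts => (ySub (M.rel R)).pullback (yMap fun e => Env.ofFn _ fun i => M.eval (ts i) e)
  | _, .eq s t => (ySub {p | p.1 = p.2}).pullback (yMap fun e => (M.eval s e, M.eval t e))
  | _, .mem s t => (ySub {p | p.1 ∈ M.seqEquiv _ p.2}).pullback
      (yMap fun e => (M.eval s e, M.eval t e))
  | _, .st t => (stSub _).pullback (yMap (M.eval t))
  | _, .fls => ⊥
  | _, .and Φ Ψ => (sem Φ).inter (sem Ψ)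
  | _, .or Φ Ψ => (sem Φ).union (sem Ψ)
  | _, .imp Φ Ψ => (sem Φ).imp (sem Ψ)
  | Γ, .all S Φ => (sem Φ).all (yMap (Prod.snd : Env M.El (S :: Γ) → Env M.El Γ))
  | Γ, .ex S Φ => (sem Φ).ex (yMap (Prod.snd : Env M.El (S :: Γ) → Env M.El Γ))

/-- A formula holds in the filter topos if its interpretation is the maximal subobject, i.e. if
every generalised element of the context satisfies it. -/
def HoldsInN {Γ : List L.Ty} (Φ : Formula L Γ) : Prop := M.sem Φ = ⊤

end Interpretation

end FilterTopos

namespace FilterTopos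

/-! ### Germs into sets -/

/-! The argument is Kripke–Joyal semantics over filters, together with a universal stage for the
premise. Let `V` be a stage at which `∀ˢᵗ x φ → ∃ˢᵗ y Ψ` holds for a germ `a` of parameters. Since
`φ` is internal, it is interpreted by `ySub P` for a set `P` (`exists_sem_eq_ySub`): the Heyting
operations and quantifiers restrict to the set-theoretic ones on subobjects of this form. A standard
element has finitely many values and a filter is closed under finite intersections, so `∀ˢᵗ x φ`
holds at a generalised element exactly when, for each actual element `x` separately, `φ x` holds
eventually (`has_all_st_imp_ySub`). For parameters restricted from `a`, the premise is therefore
represented by one filter: `V.inf Q`, obtained from `V` by adding the sets `Q x` on which `φ x`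
holds. A stage `W → V` satisfies the premise only if it factors through `V.inf Q`
(`exists_factor_inf`).

At `V.inf Q` the implication can be applied. It yields a finite cover and on each piece a finitely
valued witness for `Ψ`. All these values lie in one finite set (`exists_finite_of_has_ex_st`), which
is enumerated by a finite sequence `t`. The point is that `t` is a constant: it is standard over `V`
itself, not just over the subfilter where the premise holds, so it can be moved in front of the
implication. At any later stage satisfying the premise, `∃ y ∈ t, Ψ y` is the restriction of its
instance at `V.inf Q`. Of `Ψ` only stability under restriction and substitution (`sem_rename`) is
used, hence it may be external. -/

/-- Composition of a continuous partial map into a set with a map of sets. -/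
def Cont.mapSimple {U : FilterObj.{u}} {X Y : Type u} (a : Cont U (simple X)) (f : X → Y) :
    Cont U (simple Y) where
  dom := a.dom
  toFun x := f (a.toFun x)
  cont _ := ⟨a.dom, fun _ hx => ⟨hx, trivial⟩⟩

theorem Cont.mapSimple_maps {U : FilterObj.{u}} {X Y : Type u} {a : Cont U (simple X)}
    {f : X → Y} {x : U.carrier} {y : Y} :
    (a.mapSimple f).Maps x y ↔ ∃ v, a.Maps x v ∧ f v = y :=
  ⟨fun ⟨h, e⟩ => ⟨_, ⟨h, rfl⟩, e⟩, fun ⟨_, ⟨h, e⟩, e'⟩ => ⟨h, (congrArg f e).trans e'⟩⟩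

theorem germ_simpleMap {U : FilterObj.{u}} {X Y : Type u} (a : Cont U (simple X)) (f : X → Y) :
    germ a ≫ simpleMap f = germ (a.mapSimple f) := by
  refine germ_eq.2 ((Cont.comp_eventually a (Cont.ofFun (F := simple X) (G := simple Y) f
    fun _ => ⟨PUnit.unit, fun _ _ => Set.mem_univ _⟩)).mono ?_)
  rintro x ⟨v, w, h1, h2, h3⟩
  obtain rfl := Cont.ofFun_maps h2
  exact ⟨_, h3, Cont.mapSimple_maps.2 ⟨v, h1, rfl⟩⟩

theorem simpleMap_comp {X Y Z : Type u} (f : X → Y) (g : Y → Z) :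
    simpleMap f ≫ simpleMap g = simpleMap (g ∘ f) := by
  change germ _ ≫ simpleMap g = germ _
  rw [germ_simpleMap]
  rfl

/-- Eventual statements about the value of a composite. -/
theorem eventually_comp_maps {V U G : FilterObj.{u}} {b : Cont V U} {a : Cont U G}
    {P : V.carrier → G.carrier → Prop} :
    (∀ᶠ x in V.gen, ∃ v, P x v ∧ (b.comp a).Maps x v) ↔
      ∀ᶠ x in V.gen, ∃ y v, P x v ∧ b.Maps x y ∧ a.Maps y v := by
  constructor
  · refine fun h => h.mono ?_
    rintro x ⟨v, hv, h1⟩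
    obtain ⟨y, h2, h3⟩ := Cont.comp_maps h1
    exact ⟨y, v, hv, h2, h3⟩
  · intro h
    filter_upwards [h, Cont.comp_eventually b a]
    rintro x ⟨y, v, hv, h1, h2⟩ ⟨y', v', h3, h4, h5⟩
    obtain rfl := h1.unique h3
    obtain rfl := h2.unique h4
    exact ⟨_, hv, h5⟩

/-- Germs into sets lift to a weak pullback of sets. -/
theorem exists_lift {U : FilterObj.{u}} {W X Y Z : Type u} {p : X → Z} {q : Y → Z}
    {w₁ : W → X} {w₂ : W → Y} (m : X → Y → W)
    (hm : ∀ x y, p x = q y → w₁ (m x y) = x ∧ w₂ (m x y) = y)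
    {s : U ⟶ simple X} {t : U ⟶ simple Y} (h : s ≫ simpleMap p = t ≫ simpleMap q) :
    ∃ r : U ⟶ simple W, r ≫ simpleMap w₁ = s ∧ r ≫ simpleMap w₂ = t := by
  obtain ⟨a, rfl⟩ := germ_surj s
  obtain ⟨b, rfl⟩ := germ_surj t
  rw [germ_simpleMap, germ_simpleMap, germ_eq] at h
  obtain ⟨c, hc⟩ := Cont.exists_of_rel (F := U) (G := simple W)
    (fun u w => ∃ x y, a.Maps u x ∧ b.Maps u y ∧ p x = q y ∧ m x y = w)
    (fun _ => h.mono fun u ⟨z, h1, h2⟩ => by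
      obtain ⟨x, hx, hxz⟩ := Cont.mapSimple_maps.1 h1
      obtain ⟨y, hy, hyz⟩ := Cont.mapSimple_maps.1 h2
      exact ⟨m x y, trivial, x, y, hx, hy, hxz.trans hyz.symm, rfl⟩)
    (by
      rintro u _ _ ⟨x, y, hx, hy, -, rfl⟩ ⟨x', y', hx', hy', -, rfl⟩
      rw [hx.unique hx', hy.unique hy'])
  refine ⟨germ c, ?_, ?_⟩
  all_goals
    rw [germ_simpleMap, germ_eq]
    refine c.eventually_defined.mono fun u ⟨w, hw⟩ => ?_
    obtain ⟨x, y, hx, hy, e, rfl⟩ := hc _ _ hw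
  · exact ⟨x, Cont.mapSimple_maps.2 ⟨_, hw, (hm x y e).1⟩, hx⟩
  · exact ⟨y, Cont.mapSimple_maps.2 ⟨_, hw, (hm x y e).2⟩, hy⟩

/-! ### Subfilters -/

namespace FilterObj

variable (U : FilterObj.{u}) {I : Type u} (P : I → Set U.carrier)

/-- The filter generated by a filter and a family of sets. -/
def inf : FilterObj.{u} where
  carrier := U.carrier
  -- Only finitely many of the `P j` are imposed at once. Appending lists gives directedness, and `I
  -- : Type u` keeps the index set in `Type u`.
  Idx := U.Idx × List I
  base i := {x | x ∈ U.base i.1 ∧ ∀ j ∈ i.2, x ∈ P j}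
  inhabited := ⟨(U.inhabited.some, [])⟩
  directed i j := by
    obtain ⟨k, hk⟩ := U.directed i.1 j.1
    exact ⟨(k, i.2 ++ j.2), fun x hx =>
      ⟨⟨(hk hx.1).1, fun l hl => hx.2 l (List.mem_append_left _ hl)⟩,
        ⟨(hk hx.1).2, fun l hl => hx.2 l (List.mem_append_right _ hl)⟩⟩⟩

variable {U P} in
theorem eventually_inf {Q : U.carrier → Prop} :
    (∀ᶠ x in (U.inf P).gen, Q x) ↔
      ∃ l : List I, ∀ᶠ x in U.gen, (∀ j ∈ l, x ∈ P j) → Q x :=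
  ⟨fun ⟨i, hi⟩ => ⟨i.2, i.1, fun _ hx h => hi ⟨hx, h⟩⟩,
    fun ⟨l, i, hi⟩ => ⟨(i, l), fun _ hx => hi hx.1 hx.2⟩⟩

theorem eventually_inf_mem (j : I) : ∀ᶠ x in (U.inf P).gen, x ∈ P j :=
  eventually_inf.2 ⟨[j], Eventually.of_forall fun _ hx => hx j (by simp)⟩

/-- The inclusion of a subfilter. -/
noncomputable def inclInf : Cont (U.inf P) U :=
  Cont.ofFun (F := U.inf P) (fun x => x) fun j => ⟨(j, []), fun _ hx => hx.1⟩

theorem inclInf_eventually : ∀ᶠ x in (U.inf P).gen, (U.inclInf P).Maps x x :=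
  Cont.ofFun_eventually (F := U.inf P) (G := U) (fun x => x) _

-- Universal property of `U.inf P`. The graph of `a` itself serves as the factorisation; only
-- continuity is at stake, and it holds because each base set of `U.inf P` involves finitely many `P
-- j`, whose eventual preimages can be intersected.
variable {U P} in
theorem exists_factor_inf {V : FilterObj.{u}} (a : Cont V U)
    (h : ∀ j, ∀ᶠ x in V.gen, ∃ y ∈ P j, a.Maps x y) :
    ∃ g : V ⟶ U.inf P, g ≫ germ (U.inclInf P) = germ a := by
  obtain ⟨b, hb⟩ := Cont.exists_of_rel (G := U.inf P) (fun x y => a.Maps x y) (fun i => by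
    have h1 : ∀ᶠ x in V.gen, ∀ j ∈ i.2, ∃ y ∈ P j, a.Maps x y :=
      (eventually_all_finite i.2.finite_toSet).2 fun j _ => h j
    filter_upwards [h1, a.eventually_maps (U.eventually_base i.1)]
    rintro x h2 ⟨y, hy, hxy⟩
    refine ⟨y, ⟨hy, fun j hj => ?_⟩, hxy⟩
    obtain ⟨z, hz, hxz⟩ := h2 j hj
    rwa [hxy.unique hxz]) fun _ _ _ h1 h2 => h1.unique h2
  refine ⟨germ b, germ_eq.2 ((Cont.comp_eventually b (U.inclInf P)).mono ?_)⟩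
  rintro x ⟨y, z, h1, h2, h3⟩
  obtain rfl := Cont.ofFun_maps h2
  exact ⟨y, h3, hb _ _ h1⟩

/-- Case distinction as a cover. Finiteness of `ι` lets the eventual conditions on the pieces be
imposed simultaneously. -/
theorem isKCover_inf {ι : Type} [Finite ι] (P : ι → Set U.carrier)
    (h : ∀ᶠ x in U.gen, ∃ k, x ∈ P k) :
    IsKCover (fun k => U.inf fun _ : PUnit.{u + 1} => P k)
      fun k => germ (U.inclInf fun _ : PUnit.{u + 1} => P k) := by
  refine isKCover_of_eventually _ fun Q hQ => ?_
  have h1 : ∀ k, ∀ᶠ x in U.gen, x ∈ P k → Q k x ∧ (U.inclInf fun _ : PUnit => P k).Maps x x := by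
    intro k
    obtain ⟨l, hl⟩ := eventually_inf.1 ((hQ k).and (U.inclInf_eventually fun _ => P k))
    exact hl.mono fun x hx hP => hx fun _ _ => hP
  filter_upwards [h, eventually_all.2 h1]
  rintro x ⟨k, hk⟩ h2
  exact ⟨k, x, h2 k hk⟩

end FilterObj

/-! ### Generalised elements of subobjects of representable sheaves -/

namespace Subsheaf

variable {X Y Z W : Type u} {U V : FilterObj.{u}}

/-- A generalised element of a representable sheaf belongs to a subobject. -/
def Has (A : Subsheaf (ySet X)) (s : U ⟶ simple X) : Prop :=
  (ULift.up s : (ySet X).obj.obj (op U)) ∈ A.sub.obj (op U)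

theorem le_iff_has {A B : Subsheaf (ySet X)} :
    A ≤ B ↔ ∀ (U : FilterObj.{u}) (s : U ⟶ simple X), A.Has s → B.Has s :=
  le_iff.trans ⟨fun h U s hs => h (op U) (ULift.up s) hs, fun h U s hs => h U.unop s.down hs⟩

theorem ext_has {A B : Subsheaf (ySet X)}
    (h : ∀ (U : FilterObj.{u}) (s : U ⟶ simple X), A.Has s ↔ B.Has s) : A = B :=
  le_antisymm (le_iff_has.2 fun U s => (h U s).1) (le_iff_has.2 fun U s => (h U s).2)

theorem ext_has_germ {A B : Subsheaf (ySet X)}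
    (h : ∀ (U : FilterObj.{u}) (a : Cont U (simple X)), A.Has (germ a) ↔ B.Has (germ a)) :
    A = B :=
  ext_has fun U s => by
    obtain ⟨a, rfl⟩ := germ_surj s
    exact h U a

theorem Has.comp {A : Subsheaf (ySet X)} {s : U ⟶ simple X} (h : A.Has s) (f : V ⟶ U) :
    A.Has (f ≫ s) :=
  A.sub.map (U := op U) (V := op V) f.op h

theorem has_of_cover (A : Subsheaf (ySet X)) {s : U ⟶ simple X} {ι : Type} [Finite ι]
    {G : ι → FilterObj.{u}} {β : ∀ k, G k ⟶ U} (h : IsKCover G β) (hA : ∀ k, A.Has (β k ≫ s)) :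
    A.Has s :=
  A.mem_of_local (A.sub.sieveOfSection (ULift.up s)) ⟨ι, inferInstance, G, β, h, hA⟩
    fun _ _ hf => hf

/-- Here and in the next lemmas: the Kripke–Joyal clauses, obtained by unfolding the operations on
subsheaves. -/
theorem has_pullback {f : X → Y} {B : Subsheaf (ySet Y)} {s : U ⟶ simple X} :
    (B.pullback (yMap f)).Has s ↔ B.Has (s ≫ simpleMap f) := Iff.rfl

theorem has_inter {A B : Subsheaf (ySet X)} {s : U ⟶ simple X} :
    (A.inter B).Has s ↔ A.Has s ∧ B.Has s := Iff.rfl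

theorem has_imp {A B : Subsheaf (ySet X)} {s : U ⟶ simple X} :
    (A.imp B).Has s ↔ ∀ (V : FilterObj.{u}) (f : V ⟶ U), A.Has (f ≫ s) → B.Has (f ≫ s) :=
  ⟨fun h V f => h (op V) f.op, fun h V f => h V.unop f.unop⟩

theorem has_all {f : X → Y} {A : Subsheaf (ySet X)} {s : U ⟶ simple Y} :
    (A.all (yMap f)).Has s ↔ ∀ (V : FilterObj.{u}) (g : V ⟶ U) (t : V ⟶ simple X),
      t ≫ simpleMap f = g ≫ s → A.Has t :=
  ⟨fun h V g t e => h (op V) g.op ⟨t⟩ (congrArg ULift.up e),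
    fun h V g t e => h V.unop g.unop t.down (congrArg ULift.down e)⟩

theorem has_union {A B : Subsheaf (ySet X)} {s : U ⟶ simple X} :
    (A.union B).Has s ↔ ∃ (ι : Type) (_ : Finite ι) (G : ι → FilterObj.{u}) (β : ∀ k, G k ⟶ U),
      IsKCover G β ∧ ∀ k, A.Has (β k ≫ s) ∨ B.Has (β k ≫ s) := Iff.rfl

theorem has_ex {f : X → Y} {A : Subsheaf (ySet X)} {s : U ⟶ simple Y} :
    (A.ex (yMap f)).Has s ↔ ∃ (ι : Type) (_ : Finite ι) (G : ι → FilterObj.{u})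
      (β : ∀ k, G k ⟶ U), IsKCover G β ∧
        ∀ k, ∃ t : G k ⟶ simple X, A.Has t ∧ t ≫ simpleMap f = β k ≫ s := by
  constructor
  · rintro ⟨ι, hι, G, β, hβ, h⟩
    refine ⟨ι, hι, G, β, hβ, fun k => ?_⟩
    obtain ⟨t, ht, e⟩ := h k
    exact ⟨t.down, ht, congrArg ULift.down e⟩
  · rintro ⟨ι, hι, G, β, hβ, h⟩
    refine ⟨ι, hι, G, β, hβ, fun k => ?_⟩
    obtain ⟨t, ht, e⟩ := h k
    exact ⟨⟨t⟩, ht, congrArg ULift.up e⟩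

theorem Has.ex {f : X → Y} {A : Subsheaf (ySet X)} {t : U ⟶ simple X} (h : A.Has t) :
    (A.ex (yMap f)).Has (t ≫ simpleMap f) :=
  le_iff_has.1 (ex_le.1 (le_refl (A.ex (yMap f)))) U t h

/-! ### Heyting operations on subobjects given by subsets -/

theorem has_ySub {A : Set X} {a : Cont U (simple X)} :
    (ySub A).Has (germ a) ↔ ∀ᶠ x in U.gen, ∃ v ∈ A, a.Maps x v := mem_range_incl a

theorem has_ySub_inf {I : Type u} {P : I → Set U.carrier} {A : Set X} {a : Cont U (simple X)} :
    (ySub A).Has (germ (U.inclInf P) ≫ germ a) ↔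
      ∀ᶠ x in (U.inf P).gen, ∃ v ∈ A, a.Maps x v := by
  rw [germ_comp, has_ySub]
  refine (eventually_comp_maps (G := simple X) (P := fun _ (v : X) => v ∈ A)).trans ⟨fun h => h.mono ?_, fun h => ?_⟩
  · rintro x ⟨y, v, hv, h1, h2⟩
    obtain rfl := Cont.ofFun_maps h1
    exact ⟨v, hv, h2⟩
  · filter_upwards [h, U.inclInf_eventually P]
    rintro x ⟨v, hv, h1⟩ h2
    exact ⟨x, v, hv, h2, h1⟩

theorem pullback_ySub (f : X → Y) (B : Set Y) :
    (ySub B).pullback (yMap f) = ySub (f ⁻¹' B) := by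
  refine ext_has_germ fun U a => ?_
  rw [has_pullback, germ_simpleMap, has_ySub, has_ySub]
  refine eventually_congr (Eventually.of_forall fun x => ?_)
  constructor
  · rintro ⟨y, hy, h⟩
    obtain ⟨v, hv, rfl⟩ := Cont.mapSimple_maps.1 h
    exact ⟨v, hy, hv⟩
  · rintro ⟨v, hv, h⟩
    exact ⟨_, hv, Cont.mapSimple_maps.2 ⟨v, h, rfl⟩⟩

theorem ySub_mono {A B : Set X} (h : A ⊆ B) : ySub A ≤ ySub B :=
  le_iff_has.2 fun U s hs => by
    obtain ⟨a, rfl⟩ := germ_surj s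
    exact has_ySub.2 ((has_ySub.1 hs).mono fun x ⟨v, hv, hx⟩ => ⟨v, h hv, hx⟩)

/-- A germ with values in `∅` lives on a filter with an empty base set, and such a filter is covered
by the empty family. -/
theorem bot_eq_ySub : (⊥ : Subsheaf (ySet X)) = ySub ∅ := by
  refine le_antisymm (bot_le _) (le_iff_has.2 fun U s hs => ?_)
  obtain ⟨a, rfl⟩ := germ_surj s
  refine has_of_cover (ι := Empty) _ (G := fun k => k.elim) (β := fun k => k.elim) ?_
    fun k => k.elim
  rintro - - -
  obtain ⟨i, hi⟩ := has_ySub.1 hs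
  exact ⟨i, fun x hx => by obtain ⟨v, hv, -⟩ := hi hx; exact hv.elim⟩

theorem inter_ySub (A B : Set X) : (ySub A).inter (ySub B) = ySub (A ∩ B) := by
  refine ext_has_germ fun U a => ?_
  rw [has_inter, has_ySub, has_ySub, has_ySub, ← eventually_and]
  refine eventually_congr (Eventually.of_forall fun x => ?_)
  constructor
  · rintro ⟨⟨v, hv, h⟩, w, hw, h'⟩
    obtain rfl := h.unique h'
    exact ⟨v, ⟨hv, hw⟩, h⟩
  · rintro ⟨v, ⟨hv, hv'⟩, h⟩
    exact ⟨⟨v, hv, h⟩, v, hv', h⟩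

/-- The two subfilters on which the value lies in `A`, respectively in `B`, cover the domain. -/
theorem union_ySub (A B : Set X) : (ySub A).union (ySub B) = ySub (A ∪ B) := by
  refine le_antisymm (union_le.2 ⟨ySub_mono Set.subset_union_left,
    ySub_mono Set.subset_union_right⟩) (le_iff_has.2 fun U s hs => ?_)
  obtain ⟨a, rfl⟩ := germ_surj s
  have h := U.isKCover_inf (fun k : Bool => {x | ∃ v ∈ cond k A B, a.Maps x v})
    ((has_ySub.1 hs).mono fun x ⟨v, hv, hx⟩ => hv.elim (fun h => ⟨true, v, h, hx⟩)
      fun h => ⟨false, v, h, hx⟩)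
  have key : ∀ k : Bool, (ySub (cond k A B)).Has
      (germ (U.inclInf fun _ : PUnit.{u + 1} => {x | ∃ v ∈ cond k A B, a.Maps x v}) ≫ germ a) := by
    intro k
    rw [has_ySub_inf]
    exact U.eventually_inf_mem _ PUnit.unit
  refine has_union.2 ⟨Bool, inferInstance, _, _, h, fun k => ?_⟩
  cases k
  · exact Or.inr (key false)
  · exact Or.inl (key true)

/-- It suffices to test the implication at the universal stage for its premise, the subfilter on
which the value lies in `A`. -/
theorem imp_ySub (A B : Set X) : (ySub A).imp (ySub B) = ySub {x | x ∈ A → x ∈ B} := by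
  refine le_antisymm (le_iff_has.2 fun U s hs => ?_) (le_imp.2 ?_)
  · obtain ⟨a, rfl⟩ := germ_surj s
    have h := has_imp.1 hs _ (germ (U.inclInf fun _ : PUnit.{u + 1} => {x | ∃ v ∈ A, a.Maps x v}))
    rw [has_ySub_inf, has_ySub_inf] at h
    obtain ⟨l, hl⟩ := FilterObj.eventually_inf.1 (h (U.eventually_inf_mem _ PUnit.unit))
    rw [has_ySub]
    filter_upwards [hl, a.eventually_defined]
    rintro x hx ⟨v, hv⟩
    refine ⟨v, fun hA => ?_, hv⟩
    obtain ⟨w, hw, h'⟩ := hx fun _ _ => ⟨v, hA, hv⟩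
    rwa [hv.unique h']
  · rw [inter_ySub]
    exact ySub_mono fun x hx => hx.1 hx.2

/-- A choice of preimages over `f '' A` lifts the germ globally, so no nontrivial cover is needed.
-/
theorem ex_ySub (f : X → Y) (A : Set X) : (ySub A).ex (yMap f) = ySub (f '' A) := by
  refine le_antisymm (ex_le.2 ?_) (le_iff_has.2 fun U s hs => ?_)
  · rw [pullback_ySub]
    exact ySub_mono (Set.subset_preimage_image f A)
  · obtain ⟨a, rfl⟩ := germ_surj s
    choose g hgA hg using fun y : f '' A => y.2
    obtain ⟨b, hb⟩ := Cont.exists_of_rel (F := U) (G := simple X)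
      (fun u x => ∃ y : f '' A, a.Maps u (y.1 : Y) ∧ g y = x)
      (fun _ => (has_ySub.1 hs).mono fun u ⟨y, hy, hu⟩ => ⟨_, trivial, ⟨y, hy⟩, hu, rfl⟩)
      (by
        rintro u _ _ ⟨y, hy, rfl⟩ ⟨z, hz, rfl⟩
        rw [Subtype.ext (hy.unique hz)])
    have e : germ b ≫ simpleMap f = germ a := by
      rw [germ_simpleMap, germ_eq]
      refine b.eventually_defined.mono fun u ⟨x, hx⟩ => ?_
      obtain ⟨y, hy, rfl⟩ := hb _ _ hx
      exact ⟨y.1, Cont.mapSimple_maps.2 ⟨_, hx, hg y⟩, hy⟩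
    rw [← e]
    refine Has.ex (has_ySub.2 (b.eventually_defined.mono fun u ⟨x, hx⟩ => ⟨x, ?_, hx⟩))
    obtain ⟨y, hy, rfl⟩ := hb _ _ hx
    exact hgA y

/-- It suffices to test on the generic element of the fibre over the germ, the second projection of
the fibre product with all of `X`. -/
theorem all_ySub (f : X → Y) (A : Set X) :
    (ySub A).all (yMap f) = ySub {y | ∀ x, f x = y → x ∈ A} := by
  refine le_antisymm (le_iff_has.2 fun U s hs => ?_) (le_all.2 ?_)
  · obtain ⟨a, rfl⟩ := germ_surj s
    let c : Cont (simple X) (simple Y) := Cont.ofFun (F := simple X) (G := simple Y) f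
      fun _ => ⟨PUnit.unit, fun _ _ => Set.mem_univ _⟩
    have h := has_all.1 hs _ (germ (pbFst a c)) (germ (pbSnd a c)) (pb_comm a c).symm
    obtain ⟨i, hi⟩ := has_ySub.1 h
    rw [has_ySub]
    filter_upwards [U.eventually_base i.1, a.eventually_defined]
    rintro u hu ⟨y, hy⟩
    refine ⟨y, fun x hx => ?_, hy⟩
    -- `simple X` has a single base set, so a base set of the fibre product restricts only `u`;
    -- hence one base set of `U` serves every `x` in the fibre.
    obtain ⟨v, hv, hm⟩ := hi (show (u, x) ∈ _ from ⟨hu, trivial, y, hy, trivial, hx⟩)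
    obtain rfl := Cont.ofFun_maps hm
    exact hv
  · rw [pullback_ySub]
    exact ySub_mono fun x hx => hx x rfl

/-! ### Inverse images of the logical operations -/

theorem pullback_pullback (f : X → Y) (g : Y → Z) (A : Subsheaf (ySet Z)) :
    (A.pullback (yMap g)).pullback (yMap f) = A.pullback (yMap (g ∘ f)) :=
  ext_has fun U s => by
    rw [has_pullback, has_pullback, has_pullback, Category.assoc, simpleMap_comp]

theorem pullback_mono (f : X → Y) {A B : Subsheaf (ySet Y)} (h : A ≤ B) :
    A.pullback (yMap f) ≤ B.pullback (yMap f) :=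
  le_iff_has.2 fun U s hs => le_iff_has.1 h U (s ≫ simpleMap f) hs

theorem pullback_pullback_of_comp_eq_id {c : X → Y} {f : Y → X} (h : f ∘ c = id)
    (A : Subsheaf (ySet X)) : (A.pullback (yMap f)).pullback (yMap c) = A := by
  rw [pullback_pullback, h]
  exact ext_has fun U s => (has_pullback (f := id)).trans
    (iff_of_eq (congrArg A.Has (Category.comp_id s)))

theorem pullback_inter (f : X → Y) (A B : Subsheaf (ySet Y)) :
    (A.inter B).pullback (yMap f) = (A.pullback (yMap f)).inter (B.pullback (yMap f)) := rfl

theorem inter_le_pullback_inter {f : X → Y} {A B : Subsheaf (ySet X)} {A' B' : Subsheaf (ySet Y)}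
    (hA : A ≤ A'.pullback (yMap f)) (hB : B ≤ B'.pullback (yMap f)) :
    A.inter B ≤ (A'.inter B').pullback (yMap f) :=
  le_iff_has.2 fun U s hs => ⟨le_iff_has.1 hA U s hs.1, le_iff_has.1 hB U s hs.2⟩

theorem pullback_bot (f : X → Y) : (⊥ : Subsheaf (ySet Y)).pullback (yMap f) = ⊥ := by
  rw [bot_eq_ySub, bot_eq_ySub, pullback_ySub, Set.preimage_empty]

theorem pullback_union (f : X → Y) (A B : Subsheaf (ySet Y)) :
    (A.union B).pullback (yMap f) = (A.pullback (yMap f)).union (B.pullback (yMap f)) :=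
  ext_has fun U s => by
    simp only [has_pullback, has_union, Category.assoc]

theorem pullback_imp (f : X → Y) (A B : Subsheaf (ySet Y)) :
    (A.imp B).pullback (yMap f) = (A.pullback (yMap f)).imp (B.pullback (yMap f)) :=
  ext_has fun U s => by
    simp only [has_pullback, has_imp, Category.assoc]

/-- The Beck-Chevalley condition for universal quantification, for a weak pullback of sets. -/
theorem pullback_all {p : X → Z} {q : Y → Z} {w₁ : W → X} {w₂ : W → Y} (m : X → Y → W)
    (hw : p ∘ w₁ = q ∘ w₂) (hm : ∀ x y, p x = q y → w₁ (m x y) = x ∧ w₂ (m x y) = y)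
    (A : Subsheaf (ySet Y)) :
    (A.all (yMap q)).pullback (yMap p) = (A.pullback (yMap w₂)).all (yMap w₁) :=
  ext_has fun U s => by
    simp only [has_pullback, has_all]
    constructor
    · intro h V g t ht
      refine h V g _ ?_
      rw [Category.assoc, simpleMap_comp, ← hw, ← simpleMap_comp, ← Category.assoc, ht,
        Category.assoc]
    · intro h V g t ht
      rw [← Category.assoc] at ht
      obtain ⟨r, h1, rfl⟩ := exists_lift m hm ht.symm
      exact h V g r h1

/-- The Beck-Chevalley condition for existential quantification, for a weak pullback of sets. -/
theorem pullback_ex {p : X → Z} {q : Y → Z} {w₁ : W → X} {w₂ : W → Y} (m : X → Y → W)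
    (hw : p ∘ w₁ = q ∘ w₂) (hm : ∀ x y, p x = q y → w₁ (m x y) = x ∧ w₂ (m x y) = y)
    (A : Subsheaf (ySet Y)) :
    (A.ex (yMap q)).pullback (yMap p) = (A.pullback (yMap w₂)).ex (yMap w₁) :=
  ext_has fun U s => by
    simp only [has_pullback, has_ex]
    refine exists_congr fun ι => exists_congr fun _ => exists_congr fun G => exists_congr fun β =>
      and_congr_right fun _ => forall_congr' fun k => ?_
    constructor
    · rintro ⟨t, hA, ht⟩
      rw [← Category.assoc] at ht
      obtain ⟨r, h1, rfl⟩ := exists_lift m hm ht.symm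
      exact ⟨r, hA, h1⟩
    · rintro ⟨t, hA, ht⟩
      refine ⟨_, hA, ?_⟩
      rw [Category.assoc, simpleMap_comp, ← hw, ← simpleMap_comp, ← Category.assoc, ht,
        Category.assoc]

/-- The easy half of Beck–Chevalley, which needs the square only to commute. -/
theorem ex_le_pullback_ex {p : X → Y} {q : Z → W} {m : X → Z} {n : Y → W} (h : q ∘ m = n ∘ p)
    {A : Subsheaf (ySet X)} {B : Subsheaf (ySet Z)} (hAB : A ≤ B.pullback (yMap m)) :
    A.ex (yMap p) ≤ (B.ex (yMap q)).pullback (yMap n) := by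
  rw [ex_le, pullback_pullback, ← h, ← pullback_pullback]
  exact hAB.trans (pullback_mono m (ex_le.1 (le_refl (B.ex (yMap q)))))

/-- A section `c` provides a global witness. This is how a constant is substituted for an
existentially quantified variable. -/
theorem has_ex_of_section {f : X → Y} {c : Y → X} (h : f ∘ c = id) {A : Subsheaf (ySet X)}
    {s : U ⟶ simple Y} (hs : (A.pullback (yMap c)).Has s) : (A.ex (yMap f)).Has s := by
  have h1 := Has.ex (f := f) (has_pullback.1 hs)
  rw [Category.assoc, simpleMap_comp, h] at h1
  exact (iff_of_eq (congrArg (A.ex (yMap f)).Has (Category.comp_id s))).1 h1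

/-! ### Standard quantifiers -/

/-- Standardness is thus a union of the internal subobjects `ySub A` with `A` finite, which allows
it to be traded for internal statements. -/
theorem has_stSub {s : U ⟶ simple X} :
    (stSub X).Has s ↔ ∃ A : Set X, A.Finite ∧ (ySub A).Has s := by
  obtain ⟨a, rfl⟩ := germ_surj s
  simp only [has_ySub]
  exact finitelyValued_iff a

theorem has_ySub_const (s : U ⟶ simple X) (y : Y) {A : Set Y} (hy : y ∈ A) :
    (ySub A).Has (s ≫ simpleMap fun _ => y) := by
  obtain ⟨a, rfl⟩ := germ_surj s
  rw [germ_simpleMap, has_ySub]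
  exact a.eventually_defined.mono fun u ⟨v, hv⟩ => ⟨y, hy, Cont.mapSimple_maps.2 ⟨v, hv, rfl⟩⟩

theorem has_stSub_const (s : U ⟶ simple X) (y : Y) :
    (stSub Y).Has (s ≫ simpleMap fun _ => y) :=
  has_stSub.2 ⟨{y}, Set.finite_singleton y, has_ySub_const s y rfl⟩

/-- A universal quantifier over standard elements ranges, for an internal property, over the
elements of a set. -/
theorem has_all_st_imp_ySub {A : Set (X × Y)} {s : U ⟶ simple Y} :
    ((((stSub X).pullback (yMap Prod.fst)).imp (ySub A)).all (yMap Prod.snd)).Has s ↔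
      ∀ x, (ySub {y | (x, y) ∈ A}).Has s := by
  obtain ⟨a, rfl⟩ := germ_surj s
  rw [has_all]
  constructor
  · intro h x
    -- Instantiate the quantifier at the constant germ with value `x`, which is standard.
    have h1 := has_imp.1 (h U (𝟙 U) (germ a ≫ simpleMap fun y => (x, y)) (by
      rw [Category.assoc, simpleMap_comp, Category.id_comp]
      exact Category.comp_id _)) U (𝟙 U)
    rw [Category.id_comp, has_pullback, Category.assoc, simpleMap_comp] at h1
    have h2 : ((ySub A).pullback (yMap fun y => (x, y))).Has (germ a) :=
      h1 (has_stSub_const _ x)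
    rwa [pullback_ySub] at h2
  · intro h V g t ht
    refine has_imp.2 fun W f hf => ?_
    obtain ⟨B, hB, hfB⟩ := has_stSub.1 (has_pullback.1 hf)
    -- The finitely many eventual statements for `x ∈ B` hold simultaneously on one base set.
    have h1 : (ySub {y | ∀ x ∈ B, (x, y) ∈ A}).Has (germ a) := by
      rw [has_ySub]
      filter_upwards [(eventually_all_finite hB).2 fun x _ => has_ySub.1 (h x), a.eventually_defined]
      rintro u hu ⟨y, hy⟩
      refine ⟨y, fun x hx => ?_, hy⟩
      obtain ⟨z, hz, hm⟩ := hu x hx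
      rwa [hy.unique hm]
    have h2 := h1.comp (f ≫ g)
    rw [Category.assoc, ← ht, ← Category.assoc, ← has_pullback, pullback_ySub] at h2
    rw [← has_pullback, pullback_ySub] at hfB
    have h3 := has_inter.2 ⟨hfB, h2⟩
    rw [inter_ySub] at h3
    exact le_iff_has.1 (ySub_mono fun p hp => hp.2 p.1 hp.1) W (f ≫ t) h3

/-- Herbrand's theorem: an existential quantifier over standard elements is bounded by a finite
set. -/
theorem exists_finite_of_has_ex_st {f : X → Y} {g : X → Z} {B : Subsheaf (ySet X)}
    {s : U ⟶ simple Y} (h : ((((stSub Z).pullback (yMap g)).inter B).ex (yMap f)).Has s) :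
    ∃ A : Set Z, A.Finite ∧ ((((ySub A).pullback (yMap g)).inter B).ex (yMap f)).Has s := by
  obtain ⟨ι, hι, G, β, hβ, h⟩ := has_ex.1 h
  choose t ht e using h
  choose A hA hAt using fun k => has_stSub.1 (ht k).1
  -- Covers are finite, so the union of the finite sets of values over the pieces is still finite.
  exact ⟨⋃ k, A k, Set.finite_iUnion hA, has_ex.2 ⟨ι, hι, G, β, hβ, fun k => ⟨t k,
    ⟨le_iff_has.1 (ySub_mono (Set.subset_iUnion A k)) _ _ (hAt k), (ht k).2⟩, e k⟩⟩⟩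

end Subsheaf

/-! ### Renaming and internal formulas -/

namespace Interpretation

variable {L : Language.{v}} (M : Interpretation.{u, v} L)

theorem eval_rename {Γ Δ : List L.Ty} (ρ : Ren Γ Δ) (r : Env M.El Δ → Env M.El Γ)
    (hr : ∀ S (x : Var Γ S) e, M.evalVar x (r e) = M.evalVar (ρ S x) e) {S : L.Ty}
    (t : Term L Γ S) (e : Env M.El Δ) : M.eval (t.rename ρ) e = M.eval t (r e) := by
  induction t with
  | var x => exact (hr _ x e).symm
  | app f ts ih =>
    simp only [Term.rename, eval]
    congr 2
    exact funext ih

/-- Inverse image commutes with all connectives, and with the quantifiers by Beck–Chevalley, since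
extending both contexts by a variable gives a pullback square of sets. -/
theorem sem_rename {Γ : List L.Ty} (Φ : Formula L Γ) {Δ : List L.Ty} (ρ : Ren Γ Δ)
    (r : Env M.El Δ → Env M.El Γ)
    (hr : ∀ S (x : Var Γ S) e, M.evalVar x (r e) = M.evalVar (ρ S x) e) :
    M.sem (Φ.rename ρ) = (M.sem Φ).pullback (yMap r) := by
  have lift : ∀ {Γ Δ : List L.Ty} (ρ : Ren Γ Δ) (r : Env M.El Δ → Env M.El Γ),
      (∀ S (x : Var Γ S) e, M.evalVar x (r e) = M.evalVar (ρ S x) e) →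
      ∀ R S (x : Var (R :: Γ) S) (e : Env M.El (R :: Δ)),
        M.evalVar x ((e.1, r e.2) : Env M.El (R :: Γ)) = M.evalVar (ρ.lift R S x) e := by
    rintro Γ Δ ρ r hr R S (_ | x) e
    · rfl
    · exact hr S _ e.2
  induction Φ generalizing Δ with
  | rel R ts =>
    simp only [Formula.rename, sem, Subsheaf.pullback_pullback, M.eval_rename ρ r hr]
    rfl
  | eq s t =>
    simp only [Formula.rename, sem, Subsheaf.pullback_pullback, M.eval_rename ρ r hr]
    rfl
  | mem s t =>
    simp only [Formula.rename, sem, Subsheaf.pullback_pullback, M.eval_rename ρ r hr]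
    rfl
  | st t =>
    simp only [Formula.rename, sem, Subsheaf.pullback_pullback]
    rw [show M.eval (t.rename ρ) = M.eval t ∘ r from funext (M.eval_rename ρ r hr t)]
  | fls => exact (Subsheaf.pullback_bot r).symm
  | and Φ Ψ ih ih' =>
    simp only [Formula.rename, sem, ih ρ r hr, ih' ρ r hr, Subsheaf.pullback_inter]
  | or Φ Ψ ih ih' =>
    simp only [Formula.rename, sem, ih ρ r hr, ih' ρ r hr, Subsheaf.pullback_union]
  | imp Φ Ψ ih ih' =>
    simp only [Formula.rename, sem, ih ρ r hr, ih' ρ r hr, Subsheaf.pullback_imp]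
  | all S Φ ih =>
    simp only [Formula.rename, sem]
    rw [ih (ρ.lift S) (fun e => (e.1, r e.2)) (lift ρ r hr S)]
    -- The mediating map keeps the bound variable of `e'` and the remaining context `e`; the
    -- condition `r e = e'.2` makes both projections correct.
    exact (Subsheaf.pullback_all (p := r) (q := Prod.snd) (w₁ := Prod.snd)
      (w₂ := fun e => (e.1, r e.2)) (fun e e' => (e'.1, e)) rfl
      (fun x y h => ⟨rfl, Prod.ext rfl h⟩) (M.sem Φ)).symm
  | ex S Φ ih =>
    simp only [Formula.rename, sem]
    rw [ih (ρ.lift S) (fun e => (e.1, r e.2)) (lift ρ r hr S)]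
    exact (Subsheaf.pullback_ex (p := r) (q := Prod.snd) (w₁ := Prod.snd)
      (w₂ := fun e => (e.1, r e.2)) (fun e e' => (e'.1, e)) rfl
      (fun x y h => ⟨rfl, Prod.ext rfl h⟩) (M.sem Φ)).symm

theorem sem_weaken {Γ : List L.Ty} {S : L.Ty} (R : L.Ty) (Φ : Formula L (S :: Γ)) :
    M.sem (Φ.weaken R) = (M.sem Φ).pullback
      (yMap fun e : Env M.El (S :: R :: Γ) => ((e.1, e.2.2) : Env M.El (S :: Γ))) := by
  refine M.sem_rename Φ _ _ ?_
  rintro T (_ | x) e <;> rfl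

/-- Internal formulas are interpreted by subsets. -/
theorem exists_sem_eq_ySub {Γ : List L.Ty} (Φ : Formula L Γ) (hΦ : Φ.Internal) :
    ∃ A : Set (Env M.El Γ), M.sem Φ = ySub A := by
  induction Φ with
  | rel R ts => exact ⟨_, Subsheaf.pullback_ySub _ _⟩
  | eq s t => exact ⟨_, Subsheaf.pullback_ySub _ _⟩
  | mem s t => exact ⟨_, Subsheaf.pullback_ySub _ _⟩
  | st t => exact hΦ.elim
  | fls => exact ⟨_, Subsheaf.bot_eq_ySub⟩
  | and Φ Ψ ih ih' =>
    obtain ⟨A, hA⟩ := ih hΦ.1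
    obtain ⟨B, hB⟩ := ih' hΦ.2
    exact ⟨A ∩ B, by rw [sem, hA, hB, Subsheaf.inter_ySub]⟩
  | or Φ Ψ ih ih' =>
    obtain ⟨A, hA⟩ := ih hΦ.1
    obtain ⟨B, hB⟩ := ih' hΦ.2
    exact ⟨A ∪ B, by rw [sem, hA, hB, Subsheaf.union_ySub]⟩
  | imp Φ Ψ ih ih' =>
    obtain ⟨A, hA⟩ := ih hΦ.1
    obtain ⟨B, hB⟩ := ih' hΦ.2
    exact ⟨_, by rw [sem, hA, hB, Subsheaf.imp_ySub]⟩
  | all S Φ ih =>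
    obtain ⟨A, hA⟩ := ih hΦ
    exact ⟨_, by rw [sem, hA]; exact Subsheaf.all_ySub Prod.snd A⟩
  | ex S Φ ih =>
    obtain ⟨A, hA⟩ := ih hΦ
    exact ⟨_, by rw [sem, hA]; exact Subsheaf.ex_ySub Prod.snd A⟩

theorem sem_allSt {Γ : List L.Ty} {S : L.Ty} (Φ : Formula L (S :: Γ)) :
    M.sem (Φ.allSt S) = (((stSub (M.El S)).pullback (yMap Prod.fst)).imp (M.sem Φ)).all
      (yMap (Prod.snd : Env M.El (S :: Γ) → Env M.El Γ)) := rfl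

/-- Weakening under the bounded quantifier is, definitionally, a renaming of the whole quantified
formula. -/
theorem sem_allSt_weaken {Γ : List L.Ty} {S : L.Ty} (R : L.Ty) (Φ : Formula L (S :: Γ)) :
    M.sem ((Φ.weaken R).allSt S) = (M.sem (Φ.allSt S)).pullback
      (yMap (Prod.snd : Env M.El (R :: Γ) → Env M.El Γ)) :=
  M.sem_rename (Φ.allSt S) (fun _ x => .succ x) Prod.snd fun _ _ _ => rfl

theorem sem_exMem {Γ : List L.Ty} {T : L.Ty} (Φ : Formula L (T :: L.seq T :: Γ)) :
    M.sem (Formula.exMem (.var .zero) Φ) =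
      (((ySub {p | p.1 ∈ M.seqEquiv T p.2}).pullback
        (yMap fun e : Env M.El (T :: L.seq T :: Γ) => (e.1, e.2.1))).inter (M.sem Φ)).ex
          (yMap (Prod.snd : Env M.El (T :: L.seq T :: Γ) → Env M.El (L.seq T :: Γ))) := rfl

/-- If all values of `y` lie in a list `t`, then `Ψ y` for some `y` implies `∃ y ∈ t, Ψ y`. -/
theorem ex_ySub_le_sem_exMem {Γ : List L.Ty} {T : L.Ty} (Ψ : Formula L (T :: Γ)) {A : Set (M.El T)}
    (t : M.El (L.seq T)) (ht : ∀ y ∈ A, y ∈ M.seqEquiv T t) :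
    (((ySub A).pullback (yMap Prod.fst)).inter (M.sem Ψ)).ex
        (yMap (Prod.snd : Env M.El (T :: Γ) → Env M.El Γ)) ≤
      (M.sem (Formula.exMem (Γ := L.seq T :: Γ) (.var .zero) (Ψ.weaken (L.seq T)))).pullback
        (yMap fun e => ((t, e) : Env M.El (L.seq T :: Γ))) := by
  -- Inserts the constant `t` as the value of the variable added by weakening; forgetting that
  -- variable again gives the identity.
  let m : Env M.El (T :: Γ) → Env M.El (T :: L.seq T :: Γ) := fun p => (p.1, t, p.2)
  have h1 : (ySub A).pullback (yMap (Prod.fst : Env M.El (T :: Γ) → M.El T)) ≤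
      ((ySub {p | p.1 ∈ M.seqEquiv T p.2}).pullback
        (yMap fun e : Env M.El (T :: L.seq T :: Γ) => (e.1, e.2.1))).pullback (yMap m) := by
    rw [Subsheaf.pullback_pullback, Subsheaf.pullback_ySub, Subsheaf.pullback_ySub]
    exact Subsheaf.ySub_mono fun p hp => ht _ hp
  have h2 : (M.sem (Ψ.weaken (L.seq T))).pullback (yMap m) = M.sem Ψ :=
    (congrArg (Subsheaf.pullback (yMap m)) (M.sem_weaken (L.seq T) Ψ)).trans
      (Subsheaf.pullback_pullback_of_comp_eq_id rfl (M.sem Ψ))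
  rw [sem_exMem]
  refine Subsheaf.ex_le_pullback_ex (m := m) (p := Prod.snd) (q := Prod.snd)
    (n := fun e => (t, e)) rfl ?_
  exact Subsheaf.inter_le_pullback_inter h1 h2.ge

end Interpretation

end FilterTopos

/-! ### The herbrandised independence of premise principle -/

open FilterTopos in
/-- Every generalised element of the context satisfies the instance of the herbrandised
independence of premise principle. -/
theorem FilterTopos.Interpretation.has_sem_hip {L : Language.{v}} (M : Interpretation.{u, v} L)
    {Γ : List L.Ty} {S T : L.Ty} (φ : Formula L (S :: Γ)) (hφ : φ.Internal)
    (Ψ : Formula L (T :: Γ)) {U : FilterObj.{u}} (s : U ⟶ simple (Env M.El Γ)) :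
    (M.sem (Formula.hip φ Ψ)).Has s := by
  refine Subsheaf.has_imp.2 fun V f h => ?_
  obtain ⟨a, ha⟩ := germ_surj (f ≫ s)
  rw [← ha] at h ⊢
  obtain ⟨P, hP⟩ := M.exists_sem_eq_ySub φ hφ
  have hst : ∀ {W : FilterObj.{u}} {b : W ⟶ simple (Env M.El Γ)},
      (M.sem (φ.allSt S)).Has b ↔
        ∀ x, (ySub {e | ((x, e) : Env M.El (S :: Γ)) ∈ P}).Has b := by
    intro W b
    rw [sem_allSt, hP]
    exact Subsheaf.has_all_st_imp_ySub
  -- `Q x` is the part of `V` on which `φ x` holds for the parameters `a`, so `V.inf Q` is the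
  -- universal stage over `V` for `∀ˢᵗ x φ`.
  let Q : M.El S → Set V.carrier := fun x =>
    {u | ∃ e, ((x, e) : Env M.El (S :: Γ)) ∈ P ∧ a.Maps u e}
  have hG : (M.sem (φ.allSt S)).Has (germ (V.inclInf Q) ≫ germ a) :=
    hst.2 fun x => Subsheaf.has_ySub_inf.2 (V.eventually_inf_mem Q x)
  obtain ⟨A, hA, hE⟩ := Subsheaf.exists_finite_of_has_ex_st
    (Subsheaf.has_imp.1 h _ (germ (V.inclInf Q)) hG)
  -- Any enumeration of the finite set of possible witnesses. It is an element of a set, not a germ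
  -- on `V.inf Q`, so it makes sense over all of `V`.
  let t : M.El (L.seq T) := (M.seqEquiv T).symm hA.toFinset.toList
  have ht : ∀ y ∈ A, y ∈ M.seqEquiv T t := by simp [t]
  let c : Env M.El Γ → Env M.El (L.seq T :: Γ) := fun e => (t, e)
  -- The outer existential is witnessed by the constant `t`. Its standardness is immediate, leaving
  -- the inner implication over `V`.
  refine Subsheaf.has_ex_of_section (c := c) rfl ⟨Subsheaf.le_iff_has.1
    (Subsheaf.pullback_pullback c (M.eval (.var .zero)) (stSub _)).ge V (germ a)
    (Subsheaf.has_stSub_const (germ a) t), ?_⟩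
  refine Subsheaf.le_iff_has.1 (Subsheaf.pullback_imp c _ _).ge _ _
    (Subsheaf.has_imp.2 fun W g hg => ?_)
  have e := (congrArg (Subsheaf.pullback (yMap c)) (M.sem_allSt_weaken (L.seq T) φ)).trans
    (Subsheaf.pullback_pullback_of_comp_eq_id rfl _)
  replace hg := hst.1 (Subsheaf.le_iff_has.1 e.le _ _ hg)
  obtain ⟨b, rfl⟩ := germ_surj g
  -- The premise at `W` says that `b` eventually lands in each `Q x`, so `b` factors through the
  -- universal stage, and the conclusion known there restricts along `d`.
  obtain ⟨d, hd⟩ := FilterObj.exists_factor_inf (P := Q) b fun x => by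
    refine (Subsheaf.has_ySub.1 (hg x)).mono ?_
    rintro u ⟨e, he, hu⟩
    obtain ⟨y, h1, h2⟩ := Cont.comp_maps hu
    exact ⟨y, ⟨e, he, h2⟩, h1⟩
  have h1 := Subsheaf.le_iff_has.1 (M.ex_ySub_le_sem_exMem Ψ t ht) _ _ (hE.comp d)
  rwa [← Category.assoc, hd] at h1

theorem mainTheorem6 (L : FilterTopos.Language.{v}) (M : FilterTopos.Interpretation.{u, v} L)
    (Γ : List L.Ty) (S T : L.Ty)
    (φ : FilterTopos.Formula L (S :: Γ)) (hφ : φ.Internal) (Ψ : FilterTopos.Formula L (T :: Γ)) :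
    M.HoldsInN (FilterTopos.Formula.hip φ Ψ) :=
  le_antisymm (FilterTopos.Subsheaf.le_top _)
    (FilterTopos.Subsheaf.le_iff_has.2 fun _ s _ => M.has_sem_hip φ hφ Ψ s)
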